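/- **Setting.** Let $J,\mu,\Delta\in\mathbb R$, $T>0$, let $N$ be even, and let $a_1,\dots,a_N$ be the fermionic annihilation operators of $N$ sites on the $2^N$-dimensional Fock space, with $a_{N+1}=-a_1$. For $\kappa:[1,\infty)\to\mathbb R$ put $\kappa^{(N)}_l=\kappa_{\min(l,N-l)}$ for $1\le l\le N-1$ and let $$H_\Delta=-\frac J2\sum_{j=1}^N(a_j^\dagger a_{j+1}+a_{j+1}^\dagger a_j)-\mu\sum_{j=1}^N\Big(a_j^\dagger a_j-\frac12\Big)+\frac\Delta2\sum_{j=1}^{N-1}\sum_{l=1}^{N-j}\kappa^{(N)}_l(a_ja_{j+l}+a_{j+l}^\dagger a_j^\dagger)$$ be the long-range Kitaev Hamiltonian. For a Hermitian control $H_c(t)$, $0\le t\le T$, let $U$ be an evolution operator of $H_\Delta+H_c$, i.e. $U(0)=1$ and $U'=-i(H_\Delta+H_c)U$ on $[0,T]$, and let $G=\int_0^T U(\tau)^\dagger(\partial_\Delta H_\Delta)U(\tau)\,d\tau$. The quantum Fisher information (QFI) for estimating $\Delta$ with normalized initial state $\psi$ is $4\operatorname{Var}_\psi(G)$, and $I_0(\Delta)$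 denotes its supremum over all controls $H_c$ and all $\psi$. Finally put $$f(k)=2\sum_{l=1}^{N/2-1}\kappa_l\sin(kl)+\kappa_{N/2}\sin(kN/2),\qquad \gamma(N)=\sum_k|f(k)|,$$ the sum being over $k=(2n+1)\pi/N$, $n=0,\dots,N-1$. **Theorem.** 1. For every $\kappa$ and every even $N$, the supremum is attained and $I_0(\Delta)=[\gamma(N)/2]^2\,T^2$. In 2–4, $J,\mu,\Delta,T,\kappa$ are fixed and $N\to\infty$ through the even numbers. $A\sim B$ means that $A$ and $B$ are of the same order, $A=\Theta(B)$. *Super-Heisenberg* means $N^2=o(I_0(\Delta))$. 2. Let $\kappa$ be a decay law, that is, a bounded nonincreasing function on $[1,\infty)$ with $\kappa_1=1$ that is right-continuous at $1$. Then $$I_0(\Delta)\sim N^2\Big[\int_1^N\frac{\kappa_x}{x}\,dx\Big]^2,\qquad\text{and hence}\qquad I_0(\Delta)=O\big(N^2(\ln N)^2\big).$$ 3. Let $\kappa_x=x^{-\alpha}$ with $\alpha\ge0$. Then $I_0(\Delta)\sim N^2(\ln N)^2$ if $\alpha=0$ and $I_0(\Delta)\sim N^2$ if $\alpha>0$. The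 scaling is super-Heisenberg if and only if $\alpha=0$. 4. Let $\kappa_x=(1+\ln x)^{-\alpha}$ with $\alpha\ge0$. Then $$I_0(\Delta)\sim\begin{cases}N^2(\ln N)^{2(1-\alpha)}&0\le\alpha<1,\\ N^2(\ln\ln N)^2&\alpha=1,\\ N^2&\alpha>1.\end{cases}$$ The scaling is super-Heisenberg if and only if $\alpha\le1$. -/

import Mathlib

open Filter Asymptotics Matrix

noncomputable section

namespace LRK

/-! ## Fermions on `N` lattice sites -/

/-- Operators on the fermionic Fock space of `N` sites, as matrices in the occupation basis: a
basis state is the set `S` of occupied sites. Sites are numbered `0, …, N - 1`. -/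
abbrev FockOp (N : ℕ) : Type := Matrix (Finset (Fin N)) (Finset (Fin N)) ℂ

/-- The annihilation operator of site `j`: it empties an occupied site, with the sign
`(-1) ^ (number of occupied sites before j)`, and kills a state whose site `j` is empty. -/
def annih (N : ℕ) (j : Fin N) : FockOp N :=
  Matrix.of fun S' S =>
    if j ∈ S ∧ S' = S.erase j then (-1 : ℂ) ^ (S.filter (fun i => i < j)).card else 0

/-- The annihilation operators `a j` for all `j : ℕ`, extended beyond the chain by the
anti-periodic boundary condition `a (j + N) = - a j`. -/
def site (N j : ℕ) : FockOp N :=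
  if h : j % N < N then (-1 : ℂ) ^ (j / N) • annih N ⟨j % N, h⟩ else 0

/-- The pairing coefficient at distance `l`, with the symmetry `κ l = κ (N - l)`. -/
def kappaSymm (κ : ℝ → ℝ) (N l : ℕ) : ℝ := κ ((min l (N - l) : ℕ) : ℝ)

/-- The long-range Kitaev Hamiltonian with tunneling rate `J`, chemical potential `μ`, pairing
strength `Δ`. -/
def hamiltonian (κ : ℝ → ℝ) (N : ℕ) (J μ Δ : ℝ) : FockOp N :=
  (-(J / 2 : ℝ) : ℂ) • ∑ j ∈ Finset.range N,
      ((site N j)ᴴ * site N (j + 1) + (site N (j + 1))ᴴ * site N j)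
    - (μ : ℂ) • ∑ j ∈ Finset.range N, ((site N j)ᴴ * site N j - (1 / 2 : ℂ) • 1)
    + ((Δ / 2 : ℝ) : ℂ) • ∑ j ∈ Finset.range (N - 1), ∑ l ∈ Finset.Icc 1 (N - 1 - j),
      (kappaSymm κ N l : ℂ) •
        (site N j * site N (j + l) + (site N (j + l))ᴴ * (site N j)ᴴ)

/-- The derivative `∂H/∂Δ` of the Hamiltonian with respect to the pairing strength. -/
def dHamiltonian (κ : ℝ → ℝ) (N : ℕ) (J μ Δ : ℝ) : FockOp N :=
  Matrix.of fun S' S => deriv (fun D : ℝ => hamiltonian κ N J μ D S' S) Δ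

/-! ## Quantum Fisher information with coherent control -/

/-- `U` is the evolution operator on `[0, T]` of the time-dependent Hamiltonian `H`:
`U 0 = 1` and `U' = - i H U` (with `ħ = 1`). -/
structure IsEvolution {N : ℕ} (T : ℝ) (H U : ℝ → FockOp N) : Prop where
  init : U 0 = 1
  schrodinger : ∀ t ∈ Set.Icc 0 T, ∀ S' S,
    HasDerivWithinAt (fun t => U t S' S) (-Complex.I * (H t * U t) S' S) (Set.Icc 0 T) t

/-- The generator `G = ∫₀ᵀ U(τ)† D U(τ) dτ` (entrywise integral), `D` being the derivative of the
Hamiltonian with respect to the parameter. -/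
def generator {N : ℕ} (T : ℝ) (D : FockOp N) (U : ℝ → FockOp N) : FockOp N :=
  Matrix.of fun S' S => ∫ τ in (0 : ℝ)..T, ((U τ)ᴴ * D * U τ) S' S

/-- The expectation value `⟨ψ, A ψ⟩` (its real part, which is all of it for Hermitian `A`). -/
def expect {N : ℕ} (A : FockOp N) (ψ : Finset (Fin N) → ℂ) : ℝ := (star ψ ⬝ᵥ (A *ᵥ ψ)).re

/-- The quantum Fisher information `4 Var[G]` in the initial state `ψ`. -/
def qfi {N : ℕ} (G : FockOp N) (ψ : Finset (Fin N) → ℂ) : ℝ :=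
  4 * (expect (G * G) ψ - (expect G ψ) ^ 2)

/-- The values of the quantum Fisher information for estimating `Δ` in probe time `T` that can be
reached by adding a (time-dependent, Hermitian) control Hamiltonian `Hc` to the long-range Kitaev
Hamiltonian and choosing a normalized initial state `ψ`. -/
def attainableQFI (κ : ℝ → ℝ) (J μ Δ T : ℝ) (N : ℕ) : Set ℝ :=
  {I | ∃ (Hc U : ℝ → FockOp N) (ψ : Finset (Fin N) → ℂ),
    (∀ t ∈ Set.Icc 0 T, (Hc t).IsHermitian) ∧
    IsEvolution T (fun t => hamiltonian κ N J μ Δ + Hc t) U ∧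
    star ψ ⬝ᵥ ψ = 1 ∧
    I = qfi (generator T (dHamiltonian κ N J μ Δ) U) ψ}

/-- The quantum Fisher information `I₀(Δ)` under optimal control and optimal initial state. -/
def optimalQFI (κ : ℝ → ℝ) (J μ Δ T : ℝ) (N : ℕ) : ℝ := sSup (attainableQFI κ J μ Δ T N)

/-! ## The dispersion function and scalings -/

/-- `f(k) = 2 ∑_{l=1}^{N/2-1} κ_l sin (k l) + κ_{N/2} sin (k N/2)`, for even `N`. -/
def dispersion (κ : ℝ → ℝ) (N : ℕ) (k : ℝ) : ℝ :=
  2 * ∑ l ∈ Finset.Icc 1 (N / 2 - 1), κ l * Real.sin (k * l)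
    + κ ((N / 2 : ℕ) : ℝ) * Real.sin (k * ((N / 2 : ℕ) : ℝ))

/-- `γ(N) = ∑_k |f(k)|` over the momenta `k = (2 n + 1) π / N`, `n = 0, …, N - 1`. -/
def gammaSum (κ : ℝ → ℝ) (N : ℕ) : ℝ :=
  ∑ n ∈ Finset.range N, |dispersion κ N ((2 * (n : ℝ) + 1) * Real.pi / N)|

/-- A bounded, nonincreasing decay law on `[1, ∞)`, normalized by `κ 1 = 1`, without a jump at the
end point `1`. -/
structure IsDecayLaw (κ : ℝ → ℝ) : Prop where
  normalized : κ 1 = 1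
  antitone : AntitoneOn κ (Set.Ici 1)
  bounded : ∃ C : ℝ, ∀ x ∈ Set.Ici (1 : ℝ), |κ x| ≤ C
  right_cont : ContinuousWithinAt κ (Set.Ici 1) 1

/-- `N → ∞` along the even numbers. -/
def evenAtTop : Filter ℕ := atTop ⊓ 𝓟 {N | Even N}

/-- Super-Heisenberg scaling: `I` grows strictly faster than `N ^ 2`. -/
def SuperHeisenberg (I : ℕ → ℝ) : Prop := (fun N : ℕ => (N : ℝ) ^ 2) =o[evenAtTop] I

/-- The power law `κ_x = x ^ (-α)`. -/
def powerLaw (α : ℝ) : ℝ → ℝ := fun x => x ^ (-α)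

/-- The logarithmic law `κ_x = (1 + ln x) ^ (-α)`. -/
def logLaw (α : ℝ) : ℝ → ℝ := fun x => (1 + Real.log x) ^ (-α)

end LRK

end

/-!
The derivative `D = ∂H/∂Δ` is half the pairing operator, and it is diagonalized by an orthogonal
Bogoliubov transformation. The operators
`η_n = N^{-1/2} ∑ j, (cos (k_n j) a_j - sin (k_n j) a_j†)` at the anti-periodic momenta `k_n` satisfy
the canonical anticommutation relations (`mode_mul_mode`, `mode_mul_mode_conjTranspose`), and
`D = (1/4) ∑ n, f(k_n) (2 η_n† η_n - 1)` (`dHamiltonian_eq`, `pairing_eq_sum_mode`). Since every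
`2 η_n† η_n - 1` is a Hermitian involution, `‖D‖ ≤ γ(N) / 4`. Exchanging particles and holes in the
modes with `f(k_n) ≥ 0`, a common vacuum of the resulting modes is an eigenvector of `D` for
`γ(N) / 4`, and a completely filled state is one for `-γ(N) / 4`; both exist because finitely many
anticommuting operators have a common nonzero kernel vector (`exists_common_kernel`).

The evolution is unitary whatever the control is, so the generator has norm at most `T γ(N) / 4`,
which bounds the quantum Fisher information by `(γ(N) / 2) ^ 2 T ^ 2`. The control `-H` freezes the
evolution, the generator becomes `T D`, and the balanced superposition of the two extreme
eigenvectors attains the bound (`isGreatest_attainableQFI`).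

It remains to find the order of `γ(N) = ∑ k, |f(k)|`. For nonnegative couplings, testing `f` against
the sawtooth function `π - k`, whose discrete sine coefficients are `π / sin (π l / N) ≥ N / l`, gives
`γ(N) ≥ (N / π) ∑ l ≤ N/2, κ_l / l` (`harmonic_le_gammaSum`). If the couplings are moreover
nonincreasing, Abel's inequality shows that `|f(k)|` is dominated by `∑ l ≤ π / k, κ_l`; summed over
the momenta this gives an upper bound of the same form (`gammaSum_le_harmonic`). The harmonic sum is
compared with `∫ κ_x / x`, which is bounded away from zero because `κ` does not jump at `1`. A decay
law that takes a negative value is, up to a coupling of finite range, bounded above by a negative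
constant, so that `γ(N)` and `N |∫ κ_x / x|` are both of the order of `N log N`. For the
power laws and the logarithmic laws the integral is computed in closed form.
-/

namespace LRK

/-! ### The canonical anticommutation relations -/

/-- The Jordan–Wigner sign of site `j` in the configuration `S`. -/
def jwSign {N : ℕ} (j : Fin N) (S : Finset (Fin N)) : ℂ :=
  (-1 : ℂ) ^ (S.filter (fun i => i < j)).card

variable {N : ℕ}

lemma jwSign_mul_self (j : Fin N) (S : Finset (Fin N)) : jwSign j S * jwSign j S = 1 := by
  rw [jwSign, ← mul_pow]; simp

lemma star_jwSign (j : Fin N) (S : Finset (Fin N)) : star (jwSign j S) = jwSign j S := by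
  simp [jwSign]

lemma jwSign_erase_of_le {i j : Fin N} (h : j ≤ i) (S : Finset (Fin N)) :
    jwSign j (S.erase i) = jwSign j S := by
  unfold jwSign
  congr 2
  ext x
  simp only [Finset.mem_filter, Finset.mem_erase]
  constructor
  · tauto
  · rintro ⟨h1, h2⟩
    exact ⟨⟨(h2.trans_le h).ne, h1⟩, h2⟩

lemma jwSign_erase_of_lt {i j : Fin N} (h : i < j) {S : Finset (Fin N)} (hi : i ∈ S) :
    jwSign j (S.erase i) = -jwSign j S := by
  have hmem : i ∈ S.filter (fun x => x < j) := by simp [hi, h]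
  have : (S.erase i).filter (fun x => x < j) = (S.filter (fun x => x < j)).erase i := by
    ext x; simp only [Finset.mem_filter, Finset.mem_erase]; tauto
  unfold jwSign
  rw [this, ← Finset.card_erase_add_one hmem, pow_succ]
  ring

lemma jwSign_insert_of_le {i j : Fin N} (h : j ≤ i) (S : Finset (Fin N)) :
    jwSign j (insert i S) = jwSign j S := by
  rw [← jwSign_erase_of_le h (insert i S), ← jwSign_erase_of_le h S, Finset.erase_insert_eq_erase]

lemma jwSign_insert_of_lt {i j : Fin N} (h : i < j) {S : Finset (Fin N)} (hi : i ∉ S) :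
    jwSign j (insert i S) = -jwSign j S := by
  have := jwSign_erase_of_lt h (Finset.mem_insert_self i S)
  rw [Finset.erase_insert hi] at this
  rw [this, neg_neg]

lemma mul_annih_apply (A : FockOp N) (j : Fin N) (R S : Finset (Fin N)) :
    (A * annih N j) R S = if j ∈ S then jwSign j S * A R (S.erase j) else 0 := by
  rw [Matrix.mul_apply, Finset.sum_eq_single (S.erase j)]
  · by_cases h : j ∈ S <;> simp [annih, jwSign, h, mul_comm]
  · intro M _ hM
    simp [annih, hM]
  · simp

lemma mul_annih_conjTranspose_apply (A : FockOp N) (j : Fin N) (R S : Finset (Fin N)) :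
    (A * (annih N j)ᴴ) R S = if j ∈ S then 0 else jwSign j S * A R (insert j S) := by
  rw [Matrix.mul_apply, Finset.sum_eq_single (insert j S)]
  · by_cases h : j ∈ S
    · have : S ≠ S.erase j := fun h' => by rw [h'] at h; simp at h
      simp [annih, h, this]
    · have := star_jwSign j (insert j S)
      rw [jwSign_insert_of_le le_rfl] at this
      have h2 := jwSign_insert_of_le (le_refl j) S
      unfold jwSign at this h2
      simp [annih, jwSign, h, h2, mul_comm]
  · intro M _ hM
    have : ¬ (j ∈ M ∧ S = M.erase j) := by
      rintro ⟨h1, rfl⟩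
      exact hM (Finset.insert_erase h1).symm
    simp [annih, this]
  · simp

lemma annih_apply (j : Fin N) (R S : Finset (Fin N)) :
    annih N j R S = if j ∈ S then jwSign j S * (1 : FockOp N) R (S.erase j) else 0 := by
  rw [← mul_annih_apply, Matrix.one_mul]

lemma annih_conjTranspose_apply (j : Fin N) (R S : Finset (Fin N)) :
    (annih N j)ᴴ R S = if j ∈ S then 0 else jwSign j S * (1 : FockOp N) R (insert j S) := by
  rw [← mul_annih_conjTranspose_apply, Matrix.one_mul]

lemma annih_mul_annih (i j : Fin N) : annih N i * annih N j = -(annih N j * annih N i) := by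
  wlog h : i ≤ j generalizing i j
  · rw [this j i (le_of_not_ge h), neg_neg]
  ext R S
  rw [Matrix.neg_apply, mul_annih_apply, mul_annih_apply, annih_apply, annih_apply]
  rcases h.eq_or_lt with rfl | h
  · simp
  · by_cases hi : i ∈ S <;> by_cases hj : j ∈ S <;>
      simp [hi, hj, h.ne, h.ne', jwSign_erase_of_le h.le, jwSign_erase_of_lt h]
    rw [Finset.erase_right_comm]
    ring

lemma annih_mul_annih_conjTranspose (i j : Fin N) :
    annih N i * (annih N j)ᴴ = (if i = j then 1 else 0) - (annih N j)ᴴ * annih N i := by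
  ext R S
  rw [Matrix.sub_apply, mul_annih_apply, mul_annih_conjTranspose_apply, annih_apply,
    annih_conjTranspose_apply]
  rcases lt_trichotomy i j with h | rfl | h
  · by_cases hi : i ∈ S <;> by_cases hj : j ∈ S <;>
      simp [hi, hj, h.ne, h.ne', jwSign_insert_of_le h.le, jwSign_erase_of_lt h]
    rw [Finset.erase_insert_of_ne h.ne']
    ring
  · by_cases hi : i ∈ S
    · simp [hi, jwSign_erase_of_le, ← mul_assoc, jwSign_mul_self]
      rw [Finset.insert_erase hi, sub_self]
    · simp [hi, jwSign_insert_of_le, ← mul_assoc, jwSign_mul_self]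
      rw [Finset.erase_insert hi]
  · by_cases hi : i ∈ S <;> by_cases hj : j ∈ S <;>
      simp [hi, hj, h.ne, h.ne', jwSign_insert_of_lt h, jwSign_erase_of_le h.le]
    rw [Finset.erase_insert_of_ne h.ne]
    ring

/-! ### Trigonometric sums over the momenta -/

/-- The anti-periodic momenta `k_n = (2 n + 1) π / N`. -/
noncomputable def momentum (N n : ℕ) : ℝ := (2 * (n : ℝ) + 1) * Real.pi / N

lemma sum_exp_eq_zero (hN : 0 < N) {q : ℤ} (hq : ¬ (N : ℤ) ∣ q) :
    ∑ j ∈ Finset.range N, Complex.exp ((2 * Real.pi * q * j / N : ℝ) * Complex.I) = 0 := by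
  have hN' : (N : ℂ) ≠ 0 := by exact_mod_cast hN.ne'
  set z : ℂ := Complex.exp ((2 * Real.pi * q / N : ℝ) * Complex.I) with hz
  have hz1 : z ≠ 1 := by
    intro h
    rw [hz, Complex.exp_eq_one_iff] at h
    obtain ⟨m, hm⟩ := h
    apply hq
    refine ⟨m, ?_⟩
    have h2 : (2 * Real.pi * Complex.I : ℂ) ≠ 0 := by simp [Real.pi_ne_zero]
    have h3 : (2 * Real.pi * Complex.I : ℂ) * q = (2 * Real.pi * Complex.I) * (N * m) := by
      push_cast at hm
      field_simp at hm
      linear_combination (2 * Real.pi * Complex.I : ℂ) * hm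
    have := mul_left_cancel₀ h2 h3
    exact_mod_cast this
  have hzN : z ^ N = 1 := by
    rw [hz, ← Complex.exp_nat_mul, Complex.exp_eq_one_iff]
    refine ⟨q, ?_⟩
    push_cast
    field_simp
  have : ∀ j ∈ Finset.range N,
      Complex.exp ((2 * Real.pi * q * j / N : ℝ) * Complex.I) = z ^ j := by
    intro j _
    rw [hz, ← Complex.exp_nat_mul]
    congr 1
    push_cast
    ring
  rw [Finset.sum_congr rfl this, geom_sum_eq hz1, hzN, sub_self, zero_div]

lemma sum_cos_eq_zero (hN : 0 < N) {q : ℤ} (hq : ¬ (N : ℤ) ∣ q) :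
    ∑ j ∈ Finset.range N, Real.cos (2 * Real.pi * q * j / N) = 0 := by
  have := congrArg Complex.re (sum_exp_eq_zero hN hq)
  simpa only [Complex.re_sum, Complex.exp_ofReal_mul_I_re, Complex.zero_re] using this

lemma sum_sin_eq_zero (hN : 0 < N) (q : ℤ) :
    ∑ j ∈ Finset.range N, Real.sin (2 * Real.pi * q * j / N) = 0 := by
  by_cases hq : (N : ℤ) ∣ q
  · obtain ⟨m, rfl⟩ := hq
    refine Finset.sum_eq_zero fun j _ => ?_
    have : (N : ℝ) ≠ 0 := by exact_mod_cast hN.ne'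
    rw [show 2 * Real.pi * ((N * m : ℤ) : ℝ) * j / N = ((2 * m * j : ℤ) : ℝ) * Real.pi by
      push_cast; field_simp]
    exact Real.sin_int_mul_pi _
  · have := congrArg Complex.im (sum_exp_eq_zero hN hq)
    simpa only [Complex.im_sum, Complex.exp_ofReal_mul_I_im, Complex.zero_im] using this

lemma sum_cos_momentum_eq_zero (hN : 0 < N) {q : ℤ} (hq : ¬ (N : ℤ) ∣ q) :
    ∑ n ∈ Finset.range N, Real.cos (momentum N n * q) = 0 := by
  have h : ∀ n ∈ Finset.range N, Real.cos (momentum N n * q) =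
      Real.cos (2 * Real.pi * q * n / N) * Real.cos (Real.pi * q / N)
        - Real.sin (2 * Real.pi * q * n / N) * Real.sin (Real.pi * q / N) := by
    intro n _
    rw [← Real.cos_add, momentum]
    congr 1
    ring
  rw [Finset.sum_congr rfl h, Finset.sum_sub_distrib, ← Finset.sum_mul, ← Finset.sum_mul,
    sum_cos_eq_zero hN hq, sum_sin_eq_zero hN]
  simp

lemma cos_momentum_mul_self (hN : 0 < N) (n : ℕ) : Real.cos (momentum N n * N) = -1 := by
  have : (N : ℝ) ≠ 0 := by exact_mod_cast hN.ne'
  rw [momentum, div_mul_cancel₀ _ this,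
    show (2 * (n : ℝ) + 1) * Real.pi = Real.pi + n * (2 * Real.pi) by ring,
    Real.cos_add_nat_mul_two_pi, Real.cos_pi]

lemma sin_momentum_mul_self (hN : 0 < N) (n : ℕ) : Real.sin (momentum N n * N) = 0 := by
  have : (N : ℝ) ≠ 0 := by exact_mod_cast hN.ne'
  rw [momentum, div_mul_cancel₀ _ this,
    show (2 * (n : ℝ) + 1) * Real.pi = Real.pi + n * (2 * Real.pi) by ring,
    Real.sin_add_nat_mul_two_pi, Real.sin_pi]

lemma sin_momentum_mul_sub (hN : 0 < N) (n : ℕ) {l : ℕ} (hl : l ≤ N) :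
    Real.sin (momentum N n * ((N - l : ℕ) : ℝ)) = Real.sin (momentum N n * l) := by
  rw [Nat.cast_sub hl, mul_sub, Real.sin_sub, sin_momentum_mul_self hN, cos_momentum_mul_self hN]
  ring

/-- Orthogonality of the sine modes; on the anti-periodic momenta the modes `l` and `N - l`
coincide. -/
lemma sum_sin_mul_sin_momentum (hN : 0 < N) {l p : ℕ} (hl : 0 < l) (hlN : l < N) (hp : 0 < p)
    (hpN : p < N) :
    ∑ n ∈ Finset.range N, Real.sin (momentum N n * l) * Real.sin (momentum N n * p) =
      N / 2 * ((if l = p then 1 else 0) + (if l = N - p then 1 else 0)) := by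
  have h : ∀ n ∈ Finset.range N, Real.sin (momentum N n * l) * Real.sin (momentum N n * p) =
      1 / 2 * (Real.cos (momentum N n * ((l - p : ℤ) : ℝ))
        - Real.cos (momentum N n * ((l + p : ℤ) : ℝ))) := by
    intro n _
    push_cast
    rw [mul_sub (momentum N n), mul_add (momentum N n), Real.cos_sub, Real.cos_add]
    ring
  rw [Finset.sum_congr rfl h, ← Finset.mul_sum, Finset.sum_sub_distrib]
  have h1 : ∑ n ∈ Finset.range N, Real.cos (momentum N n * ((l - p : ℤ) : ℝ)) =
      if l = p then (N : ℝ) else 0 := by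
    split_ifs with hlp
    · simp [hlp]
    · apply sum_cos_momentum_eq_zero hN
      intro hd
      have := Int.eq_zero_of_abs_lt_dvd hd (by rw [abs_lt]; omega)
      omega
  have h2 : ∑ n ∈ Finset.range N, Real.cos (momentum N n * ((l + p : ℤ) : ℝ)) =
      if l = N - p then -(N : ℝ) else 0 := by
    split_ifs with hlp
    · have : ((l + p : ℤ) : ℝ) = N := by
        have : l + p = N := by omega
        exact_mod_cast this
      rw [Finset.sum_congr rfl fun n _ => by rw [this, cos_momentum_mul_self hN n]]
      simp
    · apply sum_cos_momentum_eq_zero hN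
      rintro hd
      have := Int.eq_zero_of_abs_lt_dvd (dvd_sub_self_right.mpr hd)
        (by rw [abs_lt]; omega : |(l + p : ℤ) - N| < N)
      omega
  rw [h1, h2]
  split_ifs <;> ring

lemma momentum_reflect (hN : 0 < N) {n : ℕ} (hn : n < N) :
    momentum N (N - 1 - n) = 2 * Real.pi - momentum N n := by
  have : (N : ℝ) ≠ 0 := by exact_mod_cast hN.ne'
  have h : ((N - 1 - n : ℕ) : ℝ) = N - 1 - n := by
    rw [Nat.cast_sub (by omega), Nat.cast_sub (by omega)]; simp
  rw [momentum, momentum, h]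
  field_simp
  ring

lemma sum_momentum_eq_zero_of_odd (hN : 0 < N) (g : ℝ → ℝ)
    (hg : ∀ k, g (2 * Real.pi - k) = -g k) : ∑ n ∈ Finset.range N, g (momentum N n) = 0 := by
  have h := Finset.sum_range_reflect (fun n => g (momentum N n)) N
  have h2 : ∑ n ∈ Finset.range N, g (momentum N (N - 1 - n)) =
      -∑ n ∈ Finset.range N, g (momentum N n) := by
    rw [← Finset.sum_neg_distrib]
    refine Finset.sum_congr rfl fun n hn => ?_
    rw [momentum_reflect hN (Finset.mem_range.mp hn), hg]
  linarith

lemma sin_two_pi_sub_mul (k : ℝ) (l : ℕ) :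
    Real.sin ((2 * Real.pi - k) * l) = -Real.sin (k * l) := by
  rw [show (2 * Real.pi - k) * l = -(k * l) + l * (2 * Real.pi) by ring,
    Real.sin_add_nat_mul_two_pi, Real.sin_neg]

lemma cos_two_pi_sub_mul (k : ℝ) (l : ℕ) :
    Real.cos ((2 * Real.pi - k) * l) = Real.cos (k * l) := by
  rw [show (2 * Real.pi - k) * l = -(k * l) + l * (2 * Real.pi) by ring,
    Real.cos_add_nat_mul_two_pi, Real.cos_neg]

lemma dispersion_two_pi_sub (κ : ℝ → ℝ) (N : ℕ) (k : ℝ) :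
    dispersion κ N (2 * Real.pi - k) = -dispersion κ N k := by
  simp only [dispersion, sin_two_pi_sub_mul, mul_neg, Finset.sum_neg_distrib]
  ring

/-- At the anti-periodic momenta the dispersion function is the full sine series of the symmetrized
coupling. -/
lemma dispersion_momentum (κ : ℝ → ℝ) (hN : 0 < N) (hev : Even N) (n : ℕ) :
    dispersion κ N (momentum N n) =
      ∑ l ∈ Finset.Ico 1 N, kappaSymm κ N l * Real.sin (momentum N n * l) := by
  obtain ⟨m, rfl⟩ := hev
  set N := m + m with hNm
  have hm : 0 < m := by omega
  have hhalf : N / 2 = m := by omega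
  rw [dispersion, hhalf,
    ← Finset.sum_Ico_consecutive _ (show 1 ≤ m by omega) (show m ≤ N by omega),
    Finset.sum_eq_sum_Ico_succ_bot (show m < N by omega)]
  have e1 : Finset.Icc 1 (m - 1) = Finset.Ico 1 m := by
    ext x; simp; omega
  have e2 : ∑ l ∈ Finset.Ico 1 m, kappaSymm κ N l * Real.sin (momentum N n * l) =
      ∑ l ∈ Finset.Ico 1 m, κ l * Real.sin (momentum N n * l) := by
    refine Finset.sum_congr rfl fun l hl => ?_
    rw [Finset.mem_Ico] at hl
    rw [kappaSymm, min_eq_left (by omega)]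
  have e3 : ∑ l ∈ Finset.Ico (m + 1) N, kappaSymm κ N l * Real.sin (momentum N n * l) =
      ∑ l ∈ Finset.Ico 1 m, κ l * Real.sin (momentum N n * l) := by
    have := Finset.sum_Ico_reflect
      (fun l => kappaSymm κ N l * Real.sin (momentum N n * l)) 1 (show m ≤ N + 1 by omega)
    rw [show N + 1 - m = m + 1 by omega, show N + 1 - 1 = N by omega] at this
    rw [← this]
    refine Finset.sum_congr rfl fun l hl => ?_
    rw [Finset.mem_Ico] at hl
    rw [sin_momentum_mul_sub hN n (by omega), kappaSymm, min_eq_right (by omega),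
      show N - (N - l) = l by omega]
  have e4 : kappaSymm κ N m = κ m := by rw [kappaSymm, min_eq_left (by omega)]
  rw [e1, e2, e3, e4]
  ring

lemma kappaSymm_sub (κ : ℝ → ℝ) {p : ℕ} (hp : p ≤ N) :
    kappaSymm κ N (N - p) = kappaSymm κ N p := by
  rw [kappaSymm, kappaSymm, show N - (N - p) = p by omega, min_comm]

/-- Inversion of the sine series: the couplings are recovered from the dispersion function. -/
lemma sum_dispersion_mul_sin (κ : ℝ → ℝ) (hN : 0 < N) (hev : Even N) {p : ℕ} (hp : 0 < p)
    (hpN : p < N) :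
    ∑ n ∈ Finset.range N, dispersion κ N (momentum N n) * Real.sin (momentum N n * p) =
      N * kappaSymm κ N p := by
  simp only [dispersion_momentum κ hN hev, Finset.sum_mul]
  rw [Finset.sum_comm]
  have h : ∀ l ∈ Finset.Ico 1 N, ∑ n ∈ Finset.range N,
      kappaSymm κ N l * Real.sin (momentum N n * l) * Real.sin (momentum N n * p) =
      (if l = p then N / 2 * kappaSymm κ N l else 0)
        + (if l = N - p then N / 2 * kappaSymm κ N l else 0) := by
    intro l hl
    rw [Finset.mem_Ico] at hl
    simp only [mul_assoc]
    rw [← Finset.mul_sum, sum_sin_mul_sin_momentum hN (by omega) hl.2 hp hpN]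
    split_ifs <;> ring
  rw [Finset.sum_congr rfl h, Finset.sum_add_distrib, Finset.sum_ite_eq', Finset.sum_ite_eq',
    if_pos (by rw [Finset.mem_Ico]; omega), if_pos (by rw [Finset.mem_Ico]; omega),
    kappaSymm_sub κ hpN.le]
  ring

lemma gammaSum_eq (κ : ℝ → ℝ) (N : ℕ) :
    gammaSum κ N = ∑ n ∈ Finset.range N, |dispersion κ N (momentum N n)| := rfl

/-! ### Diagonalization of the pairing Hamiltonian -/

/-- The field operator `∑ j, (u j a_j + v j a_j†)` with real amplitudes. -/
noncomputable def fieldOp (u v : Fin N → ℝ) : FockOp N :=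
  ∑ j, ((u j : ℂ) • annih N j + (v j : ℂ) • (annih N j)ᴴ)

lemma fieldOp_conjTranspose (u v : Fin N → ℝ) : (fieldOp u v)ᴴ = fieldOp v u := by
  simp [fieldOp, Matrix.conjTranspose_sum, add_comm]

/-- The anticommutator of two field operators is a scalar. -/
lemma fieldOp_mul_add_mul (u v u' v' : Fin N → ℝ) :
    fieldOp u v * fieldOp u' v' + fieldOp u' v' * fieldOp u v =
      ((∑ j, (u j * v' j + v j * u' j) : ℝ) : ℂ) • (1 : FockOp N) := by
  have key : ∀ i j : Fin N,
      ((u i : ℂ) • annih N i + (v i : ℂ) • (annih N i)ᴴ) *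
          ((u' j : ℂ) • annih N j + (v' j : ℂ) • (annih N j)ᴴ) +
        ((u' j : ℂ) • annih N j + (v' j : ℂ) • (annih N j)ᴴ) *
          ((u i : ℂ) • annih N i + (v i : ℂ) • (annih N i)ᴴ) =
      if i = j then ((u j * v' j + v j * u' j : ℝ) : ℂ) • (1 : FockOp N) else 0 := by
    intro i j
    have h1 := annih_mul_annih i j
    have h2 := annih_mul_annih_conjTranspose i j
    have h3 := annih_mul_annih_conjTranspose j i
    have h4 : (annih N i)ᴴ * (annih N j)ᴴ = -((annih N j)ᴴ * (annih N i)ᴴ) := by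
      rw [← Matrix.conjTranspose_mul, annih_mul_annih, Matrix.conjTranspose_neg,
        Matrix.conjTranspose_mul]
    simp only [add_mul, mul_add, Matrix.smul_mul, Matrix.mul_smul, smul_smul]
    rw [h1, h2, h3, h4]
    by_cases hij : i = j
    · subst hij
      simp only [if_true]
      push_cast
      module
    · simp only [if_neg hij, if_neg (Ne.symm hij)]
      module
  unfold fieldOp
  rw [Finset.sum_mul_sum, Finset.sum_mul_sum, Finset.sum_comm (γ := Fin N) (s := Finset.univ)
    (f := fun i j => ((u' i : ℂ) • annih N i + (v' i : ℂ) • (annih N i)ᴴ) *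
          ((u j : ℂ) • annih N j + (v j : ℂ) • (annih N j)ᴴ)), ← Finset.sum_add_distrib]
  simp only [← Finset.sum_add_distrib, key]
  simp [Finset.sum_smul]

/-- The Bogoliubov mode of momentum `k_n`,
`η_n = N^{-1/2} ∑ j, (cos (k_n j) a_j - sin (k_n j) a_j†)`. -/
noncomputable def mode (N n : ℕ) : FockOp N :=
  fieldOp (fun j => Real.cos (momentum N n * (j : ℕ)) / √N)
    (fun j => -Real.sin (momentum N n * (j : ℕ)) / √N)

lemma mode_mul_mode (m n : ℕ) : mode N m * mode N n = -(mode N n * mode N m) := by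
  rw [eq_neg_iff_add_eq_zero, mode, mode, fieldOp_mul_add_mul]
  rcases Nat.eq_zero_or_pos N with rfl | hN
  · simp
  have h := sum_sin_eq_zero hN ((m + n + 1 : ℕ) : ℤ)
  have hN' : (N : ℝ) ≠ 0 := by exact_mod_cast hN.ne'
  have hs : √(N : ℝ) ≠ 0 := by positivity
  rw [← Fin.sum_univ_eq_sum_range
    (fun j => Real.sin (2 * Real.pi * (((m + n + 1 : ℕ) : ℤ) : ℝ) * j / N))] at h
  have h2 : (∑ j : Fin N, (Real.cos (momentum N m * (j : ℕ)) / √N *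
      (-Real.sin (momentum N n * (j : ℕ)) / √N) +
      -Real.sin (momentum N m * (j : ℕ)) / √N * (Real.cos (momentum N n * (j : ℕ)) / √N)))
      = -(1 / (√N * √N)) *
        ∑ j : Fin N, Real.sin (2 * Real.pi * (((m + n + 1 : ℕ) : ℤ) : ℝ) * (j : ℕ) / N) := by
    rw [Finset.mul_sum]
    refine Finset.sum_congr rfl fun j _ => ?_
    rw [show 2 * Real.pi * (((m + n + 1 : ℕ) : ℤ) : ℝ) * (j : ℕ) / N =
      momentum N m * (j : ℕ) + momentum N n * (j : ℕ) by
        rw [momentum, momentum]; push_cast; field_simp; ring, Real.sin_add]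
    field_simp
    ring
  rw [h2, h]
  simp

lemma mode_mul_mode_conjTranspose {m n : ℕ} (hm : m < N) (hn : n < N) :
    mode N m * (mode N n)ᴴ + (mode N n)ᴴ * mode N m = if m = n then 1 else 0 := by
  have hN : 0 < N := by omega
  have hN' : (N : ℝ) ≠ 0 := by exact_mod_cast hN.ne'
  have hs : √(N : ℝ) ≠ 0 := by positivity
  have hss : (1 / N : ℝ) = 1 / √N * (1 / √N) := by
    rw [div_mul_div_comm, Real.mul_self_sqrt (Nat.cast_nonneg N), one_mul]
  rw [mode, mode, fieldOp_conjTranspose, fieldOp_mul_add_mul]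
  have h2 : (∑ j : Fin N, (Real.cos (momentum N m * (j : ℕ)) / √N *
      (Real.cos (momentum N n * (j : ℕ)) / √N) +
      -Real.sin (momentum N m * (j : ℕ)) / √N * (-Real.sin (momentum N n * (j : ℕ)) / √N)))
      = 1 / N *
        ∑ j : Fin N, Real.cos (2 * Real.pi * ((m - n : ℤ) : ℝ) * (j : ℕ) / N) := by
    rw [Finset.mul_sum]
    refine Finset.sum_congr rfl fun j _ => ?_
    rw [show 2 * Real.pi * ((m - n : ℤ) : ℝ) * (j : ℕ) / N =
      momentum N m * (j : ℕ) - momentum N n * (j : ℕ) by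
        rw [momentum, momentum]; push_cast; field_simp; ring, Real.cos_sub, hss]
    ring
  rw [h2, Fin.sum_univ_eq_sum_range
    (fun j => Real.cos (2 * Real.pi * ((m - n : ℤ) : ℝ) * j / N))]
  split_ifs with h
  · simp [h, hN']
  · rw [sum_cos_eq_zero hN]
    · simp
    · intro hd
      have := Int.eq_zero_of_abs_lt_dvd hd (by rw [abs_lt]; omega)
      omega

/-- The pairing operator of the sites `i` and `j`. -/
noncomputable def pairOp (i j : Fin N) : FockOp N :=
  annih N i * annih N j + (annih N j)ᴴ * (annih N i)ᴴ

lemma pairOp_comm (i j : Fin N) : pairOp i j = -pairOp j i := by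
  rw [pairOp, pairOp, annih_mul_annih i j,
    show (annih N j)ᴴ * (annih N i)ᴴ = -((annih N i)ᴴ * (annih N j)ᴴ) by
      rw [← Matrix.conjTranspose_mul, annih_mul_annih, Matrix.conjTranspose_neg,
        Matrix.conjTranspose_mul]]
  abel

lemma pairOp_self (i : Fin N) : pairOp i i = 0 := by
  have h : annih N i * annih N i = 0 := by
    have := annih_mul_annih i i
    ext R S
    have := congrFun (congrFun this R) S
    rw [Matrix.neg_apply] at this
    exact self_eq_neg.mp this
  rw [pairOp, ← Matrix.conjTranspose_mul, h]
  simp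

/-- The pairing operators are antisymmetric, so that a combination of them depends only on the
antisymmetric part of its coefficients. -/
lemma sum_smul_pairOp (C : Fin N → Fin N → ℂ) :
    ∑ i, ∑ j, C i j • pairOp i j =
      ∑ i, ∑ j, if i < j then (C i j - C j i) • pairOp i j else 0 := by
  have h : ∀ i j : Fin N, C i j • pairOp i j =
      (if i < j then C i j • pairOp i j else 0) + (if j < i then C i j • pairOp i j else 0) := by
    intro i j
    rcases lt_trichotomy i j with h | rfl | h
    · simp [h, h.not_gt]
    · simp [pairOp_self]
    · simp [h, h.not_gt]
  have h2 : ∑ i : Fin N, ∑ j : Fin N, (if j < i then C i j • pairOp i j else 0) =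
      ∑ i : Fin N, ∑ j : Fin N, if i < j then -(C j i • pairOp i j) else 0 := by
    rw [Finset.sum_comm]
    refine Finset.sum_congr rfl fun i _ => Finset.sum_congr rfl fun j _ => ?_
    rw [pairOp_comm j i, smul_neg]
  calc ∑ i, ∑ j, C i j • pairOp i j
      = ∑ i, ∑ j, (if i < j then C i j • pairOp i j else 0)
        + ∑ i, ∑ j, (if j < i then C i j • pairOp i j else 0) := by
        simp only [← Finset.sum_add_distrib, ← h]
    _ = _ := by
        rw [h2]
        simp only [← Finset.sum_add_distrib]
        refine Finset.sum_congr rfl fun i _ => Finset.sum_congr rfl fun j _ => ?_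
        split_ifs
        · rw [sub_smul, sub_eq_add_neg]
        · simp

/-- A weighted sum of number operators `L_n† L_n` of field operators is a pairing operator, provided
that the hopping part is killed by the weights. -/
lemma sum_smul_fieldOp (w : ℕ → ℝ) (u v : ℕ → Fin N → ℝ) (s : Finset ℕ)
    (huu : ∀ i j, ∑ n ∈ s, w n * (u n i * u n j) = 0)
    (hvv : ∀ i j, ∑ n ∈ s, w n * (v n i * v n j) = 0) :
    ∑ n ∈ s, (w n : ℂ) • ((fieldOp (u n) (v n))ᴴ * fieldOp (u n) (v n)) =
      ∑ i, ∑ j, ((∑ n ∈ s, w n * (v n i * u n j) : ℝ) : ℂ) • pairOp i j := by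
  have huu' : ∀ i j, ∑ n ∈ s, (w n : ℂ) * ((u n i : ℂ) * (u n j : ℂ)) = 0 := fun i j => by
    exact_mod_cast huu i j
  have hvv' : ∀ i j, ∑ n ∈ s, (w n : ℂ) * ((v n i : ℂ) * (v n j : ℂ)) = 0 := fun i j => by
    exact_mod_cast hvv i j
  have h1 : ∀ n ∈ s, (w n : ℂ) • ((fieldOp (u n) (v n))ᴴ * fieldOp (u n) (v n)) =
      ∑ i, ∑ j, (((w n : ℂ) * (v n i * u n j)) • (annih N i * annih N j)
        + ((w n : ℂ) * (v n i * v n j)) • (annih N i * (annih N j)ᴴ)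
        + ((w n : ℂ) * (u n i * u n j)) • ((annih N i)ᴴ * annih N j)
        + ((w n : ℂ) * (u n i * v n j)) • ((annih N i)ᴴ * (annih N j)ᴴ)) := by
    intro n _
    rw [fieldOp_conjTranspose, fieldOp, fieldOp, Finset.sum_mul_sum, Finset.smul_sum]
    refine Finset.sum_congr rfl fun i _ => ?_
    rw [Finset.smul_sum]
    refine Finset.sum_congr rfl fun j _ => ?_
    simp only [add_mul, mul_add, Matrix.smul_mul, Matrix.mul_smul, smul_smul, smul_add]
    module
  rw [Finset.sum_congr rfl h1, Finset.sum_comm (s := s)]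
  have h2 : ∀ i : Fin N, ∑ n ∈ s, ∑ j, (((w n : ℂ) * (v n i * u n j)) • (annih N i * annih N j)
        + ((w n : ℂ) * (v n i * v n j)) • (annih N i * (annih N j)ᴴ)
        + ((w n : ℂ) * (u n i * u n j)) • ((annih N i)ᴴ * annih N j)
        + ((w n : ℂ) * (u n i * v n j)) • ((annih N i)ᴴ * (annih N j)ᴴ)) =
      ∑ j, ((∑ n ∈ s, (w n : ℂ) * (v n i * u n j)) • (annih N i * annih N j)
        + (∑ n ∈ s, (w n : ℂ) * (v n j * u n i)) • ((annih N i)ᴴ * (annih N j)ᴴ)) := by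
    intro i
    rw [Finset.sum_comm]
    refine Finset.sum_congr rfl fun j _ => ?_
    simp only [Finset.sum_add_distrib, ← Finset.sum_smul, huu', hvv', zero_smul, add_zero]
    simp only [mul_comm (u _ i : ℂ)]
  rw [Finset.sum_congr rfl fun i _ => h2 i]
  simp only [Finset.sum_add_distrib, pairOp, smul_add]
  congr 1
  · push_cast; rfl
  · rw [Finset.sum_comm]
    push_cast
    rfl

/-- The pairing part of the long-range Kitaev Hamiltonian for `Δ = 2`. -/
noncomputable def pairing (κ : ℝ → ℝ) (N : ℕ) : FockOp N :=
  ∑ j ∈ Finset.range (N - 1), ∑ l ∈ Finset.Icc 1 (N - 1 - j),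
      (kappaSymm κ N l : ℂ) • (site N j * site N (j + l) + (site N (j + l))ᴴ * (site N j)ᴴ)

lemma site_fin (j : Fin N) : site N j = annih N j := by
  have h : (j : ℕ) % N = j := Nat.mod_eq_of_lt j.2
  have h2 : (j : ℕ) / N = 0 := Nat.div_eq_of_lt j.2
  unfold site
  rw [dif_pos (by rw [h]; exact j.2), h2]
  simp [h]

/-- Sums over a left site and a distance are sums over ordered pairs of sites. -/
lemma sum_range_sum_Icc {M : Type*} [AddCommMonoid M] (g : ℕ → ℕ → M) (N : ℕ) :
    ∑ j ∈ Finset.range (N - 1), ∑ l ∈ Finset.Icc 1 (N - 1 - j), g j (j + l) =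
      ∑ i : Fin N, ∑ j : Fin N, if i < j then g i j else 0 := by
  have h1 : ∀ j ∈ Finset.range N, ∑ l ∈ Finset.Icc 1 (N - 1 - j), g j (j + l) =
      ∑ k ∈ Finset.range N, if j < k then g j k else 0 := by
    intro j hj
    rw [Finset.mem_range] at hj
    rw [← Finset.sum_filter]
    refine Finset.sum_bij' (fun l _ => j + l) (fun k _ => k - j) ?_ ?_ ?_ ?_ ?_
    · intro l hl
      simp only [Finset.mem_Icc, Finset.mem_filter, Finset.mem_range] at hl ⊢
      omega
    · intro k hk
      simp only [Finset.mem_Icc, Finset.mem_filter, Finset.mem_range] at hk ⊢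
      omega
    · intro l _
      omega
    · intro k hk
      simp only [Finset.mem_filter] at hk
      omega
    · intros
      rfl
  have h2 : ∑ j ∈ Finset.range (N - 1), ∑ l ∈ Finset.Icc 1 (N - 1 - j), g j (j + l) =
      ∑ j ∈ Finset.range N, ∑ l ∈ Finset.Icc 1 (N - 1 - j), g j (j + l) := by
    refine Finset.sum_subset (Finset.range_subset_range.mpr (Nat.sub_le _ _)) ?_
    intro j _ hj
    rw [Finset.mem_range, not_lt] at hj
    rw [Finset.Icc_eq_empty (by omega), Finset.sum_empty]
  rw [h2, Finset.sum_congr rfl h1, ← Fin.sum_univ_eq_sum_range]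
  refine Finset.sum_congr rfl fun i _ => ?_
  rw [← Fin.sum_univ_eq_sum_range (fun k => if (i : ℕ) < k then g i k else 0)]
  rfl

lemma pairing_eq (κ : ℝ → ℝ) (N : ℕ) : pairing κ N =
    ∑ i : Fin N, ∑ j : Fin N,
      if i < j then (kappaSymm κ N (j - i) : ℂ) • pairOp i j else 0 := by
  have := sum_range_sum_Icc (fun j k => (kappaSymm κ N (k - j) : ℂ) •
    (site N j * site N k + (site N k)ᴴ * (site N j)ᴴ)) N
  simp only [Nat.add_sub_cancel_left, site_fin] at this
  exact this

/-- The Bogoliubov modes diagonalize the pairing operator. -/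
lemma pairing_eq_sum_mode (κ : ℝ → ℝ) (hev : Even N) : pairing κ N =
    ∑ n ∈ Finset.range N,
      (dispersion κ N (momentum N n) : ℂ) • ((mode N n)ᴴ * mode N n) := by
  rcases Nat.eq_zero_or_pos N with rfl | hN
  · simp [pairing]
  have hN' : (N : ℝ) ≠ 0 := by exact_mod_cast hN.ne'
  have hs : √(N : ℝ) ≠ 0 := by positivity
  have hss : (N : ℝ) * (1 / √N * (1 / √N)) = 1 := by
    rw [div_mul_div_comm, Real.mul_self_sqrt (Nat.cast_nonneg N), one_mul, mul_one_div_cancel hN']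
  unfold mode
  rw [sum_smul_fieldOp, sum_smul_pairOp, pairing_eq]
  · refine Finset.sum_congr rfl fun i _ => Finset.sum_congr rfl fun j _ => ?_
    split_ifs with hij
    · have hij' : (i : ℕ) < j := hij
      have hj := j.2
      have key := sum_dispersion_mul_sin κ hN hev (p := (j : ℕ) - i) (by omega) (by omega)
      rw [← Complex.ofReal_sub, ← Finset.sum_sub_distrib]
      congr 2
      rw [← mul_right_inj' hN', ← key, Finset.mul_sum]
      refine Finset.sum_congr rfl fun n _ => ?_
      rw [Nat.cast_sub hij'.le, mul_sub, Real.sin_sub]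
      linear_combination -(dispersion κ N (momentum N n) *
        (Real.sin (momentum N n * (j : ℕ)) * Real.cos (momentum N n * (i : ℕ))
          - Real.cos (momentum N n * (j : ℕ)) * Real.sin (momentum N n * (i : ℕ)))) * hss
    · rfl
  · intro i j
    refine sum_momentum_eq_zero_of_odd hN (fun k => dispersion κ N k *
      (Real.cos (k * (i : ℕ)) / √N * (Real.cos (k * (j : ℕ)) / √N))) fun k => ?_
    simp only [dispersion_two_pi_sub, cos_two_pi_sub_mul]
    ring
  · intro i j
    refine sum_momentum_eq_zero_of_odd hN (fun k => dispersion κ N k *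
      (-Real.sin (k * (i : ℕ)) / √N * (-Real.sin (k * (j : ℕ)) / √N))) fun k => ?_
    simp only [dispersion_two_pi_sub, sin_two_pi_sub_mul]
    ring

lemma hamiltonian_eq (κ : ℝ → ℝ) (N : ℕ) (J μ Δ : ℝ) : hamiltonian κ N J μ Δ =
    (-(J / 2 : ℝ) : ℂ) • ∑ j ∈ Finset.range N,
      ((site N j)ᴴ * site N (j + 1) + (site N (j + 1))ᴴ * site N j)
    - (μ : ℂ) • ∑ j ∈ Finset.range N, ((site N j)ᴴ * site N j - (1 / 2 : ℂ) • 1)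
    + ((Δ / 2 : ℝ) : ℂ) • pairing κ N := rfl

lemma dHamiltonian_eq (κ : ℝ → ℝ) (N : ℕ) (J μ Δ : ℝ) :
    dHamiltonian κ N J μ Δ = (1 / 2 : ℂ) • pairing κ N := by
  ext R S
  simp only [dHamiltonian, Matrix.of_apply]
  have : (fun D : ℝ => hamiltonian κ N J μ D R S) = fun D : ℝ =>
      hamiltonian κ N J μ 0 R S + (D : ℂ) * ((1 / 2 : ℂ) * pairing κ N R S) := by
    funext D
    simp only [hamiltonian_eq, Matrix.add_apply, Matrix.smul_apply, smul_eq_mul]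
    push_cast
    ring
  rw [this]
  have h : HasDerivAt (fun D : ℝ => hamiltonian κ N J μ 0 R S +
      (D : ℂ) * ((1 / 2 : ℂ) * pairing κ N R S)) (1 * ((1 / 2 : ℂ) * pairing κ N R S)) Δ :=
    ((Complex.ofRealCLM.hasDerivAt (x := Δ)).mul_const _).const_add _
  rw [h.deriv, one_mul]
  rfl

lemma sum_dispersion_momentum (κ : ℝ → ℝ) (N : ℕ) :
    ∑ n ∈ Finset.range N, dispersion κ N (momentum N n) = 0 := by
  rcases Nat.eq_zero_or_pos N with rfl | hN
  · simp
  · exact sum_momentum_eq_zero_of_odd hN _ (dispersion_two_pi_sub κ N)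

/-! ### Extreme eigenvalues of the pairing Hamiltonian -/

/-- The annihilation operator of the mode `n` after a particle-hole exchange of the modes with
`f(k_n) ≥ 0`. -/
noncomputable def excitation (κ : ℝ → ℝ) (N n : ℕ) : FockOp N :=
  if 0 ≤ dispersion κ N (momentum N n) then (mode N n)ᴴ else mode N n

lemma excitation_mul_excitation (κ : ℝ → ℝ) {m n : ℕ} (hm : m < N) (hn : n < N) :
    excitation κ N m * excitation κ N n = -(excitation κ N n * excitation κ N m) := by
  rw [eq_neg_iff_add_eq_zero]
  unfold excitation
  split_ifs with h1 h2 h2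
  · rw [← Matrix.conjTranspose_mul, ← Matrix.conjTranspose_mul, mode_mul_mode n m]
    simp
  · rw [add_comm, mode_mul_mode_conjTranspose hn hm, if_neg]
    rintro rfl
    exact h2 h1
  · rw [mode_mul_mode_conjTranspose hm hn, if_neg]
    rintro rfl
    exact h1 h2
  · rw [mode_mul_mode m n]
    simp

/-- After the particle-hole exchange every mode lowers the energy from its maximum. -/
lemma smul_mode_conjTranspose_mul_mode (κ : ℝ → ℝ) {n : ℕ} (hn : n < N) :
    (dispersion κ N (momentum N n) : ℂ) • ((mode N n)ᴴ * mode N n) =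
      (((dispersion κ N (momentum N n) + |dispersion κ N (momentum N n)|) / 2 : ℝ) : ℂ) • 1
        - ((|dispersion κ N (momentum N n)| : ℝ) : ℂ) •
          ((excitation κ N n)ᴴ * excitation κ N n) := by
  have h := mode_mul_mode_conjTranspose hn hn
  rw [if_pos rfl] at h
  unfold excitation
  split_ifs with hf
  · rw [abs_of_nonneg hf, Matrix.conjTranspose_conjTranspose, ← h]
    push_cast
    module
  · rw [abs_of_neg (not_le.mp hf)]
    push_cast
    module

lemma excitation_conjTranspose_mul_self_add (κ : ℝ → ℝ) {n : ℕ} (hn : n < N) :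
    (excitation κ N n)ᴴ * excitation κ N n + excitation κ N n * (excitation κ N n)ᴴ = 1 := by
  have h := mode_mul_mode_conjTranspose hn hn
  rw [if_pos rfl] at h
  unfold excitation
  split_ifs with hf
  · rw [Matrix.conjTranspose_conjTranspose, h]
  · rw [add_comm, h]

lemma dHamiltonian_eq_sub (κ : ℝ → ℝ) (hev : Even N) (J μ Δ : ℝ) :
    dHamiltonian κ N J μ Δ = ((gammaSum κ N / 4 : ℝ) : ℂ) • 1 - (1 / 2 : ℂ) •
      ∑ n ∈ Finset.range N, ((|dispersion κ N (momentum N n)| : ℝ) : ℂ) •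
          ((excitation κ N n)ᴴ * excitation κ N n) := by
  rw [dHamiltonian_eq, pairing_eq_sum_mode κ hev, Finset.sum_congr rfl fun n hn =>
    smul_mode_conjTranspose_mul_mode κ (Finset.mem_range.mp hn), Finset.sum_sub_distrib,
    ← Finset.sum_smul,
    ← Complex.ofReal_sum, ← Finset.sum_div, Finset.sum_add_distrib, sum_dispersion_momentum,
    ← gammaSum_eq, smul_sub, smul_smul, zero_add]
  congr 2
  push_cast
  ring

lemma dHamiltonian_eq_add (κ : ℝ → ℝ) (hev : Even N) (J μ Δ : ℝ) :
    dHamiltonian κ N J μ Δ = -((gammaSum κ N / 4 : ℝ) : ℂ) • 1 + (1 / 2 : ℂ) •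
      ∑ n ∈ Finset.range N, ((|dispersion κ N (momentum N n)| : ℝ) : ℂ) •
          (excitation κ N n * (excitation κ N n)ᴴ) := by
  have h : ∀ n ∈ Finset.range N, ((|dispersion κ N (momentum N n)| : ℝ) : ℂ) •
      ((excitation κ N n)ᴴ * excitation κ N n) = ((|dispersion κ N (momentum N n)| : ℝ) : ℂ) • 1 -
      ((|dispersion κ N (momentum N n)| : ℝ) : ℂ) • (excitation κ N n * (excitation κ N n)ᴴ) := by
    intro n hn
    rw [← excitation_conjTranspose_mul_self_add κ (Finset.mem_range.mp hn)]
    module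
  rw [dHamiltonian_eq_sub κ hev, Finset.sum_congr rfl h, Finset.sum_sub_distrib,
    ← Finset.sum_smul, ← Complex.ofReal_sum, ← gammaSum_eq]
  push_cast
  module

lemma dHamiltonian_isHermitian (κ : ℝ → ℝ) (hev : Even N) (J μ Δ : ℝ) :
    (dHamiltonian κ N J μ Δ).IsHermitian := by
  rw [dHamiltonian_eq_sub κ hev]
  simp [Matrix.IsHermitian, Matrix.conjTranspose_sum]

lemma hamiltonian_isHermitian (κ : ℝ → ℝ) (hev : Even N) (J μ Δ : ℝ) :
    (hamiltonian κ N J μ Δ).IsHermitian := by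
  have hp : (pairing κ N)ᴴ = pairing κ N := by
    rw [pairing_eq_sum_mode κ hev]
    simp [Matrix.conjTranspose_sum]
  rw [hamiltonian_eq, Matrix.IsHermitian, Matrix.conjTranspose_add, Matrix.conjTranspose_sub,
    Matrix.conjTranspose_smul (((Δ / 2 : ℝ) : ℂ)), hp]
  simp [Matrix.conjTranspose_sum, add_comm]

/-- Finitely many anticommuting matrices have a common nonzero kernel vector: starting from any
nonzero vector, apply one after the other those that do not kill the current vector. -/
lemma exists_common_kernel {ι m : Type*} [Fintype m] [DecidableEq m] [Nonempty m]
    (x : ι → Matrix m m ℂ) (s : Finset ι)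
    (hx : ∀ i ∈ s, ∀ j ∈ s, x i * x j = -(x j * x i)) :
    ∃ v : m → ℂ, v ≠ 0 ∧ ∀ i ∈ s, x i *ᵥ v = 0 := by
  classical
  induction s using Finset.induction_on with
  | empty => exact ⟨1, one_ne_zero, by simp⟩
  | insert a s _ ih =>
    obtain ⟨v, hv, hs⟩ := ih fun i hi j hj =>
      hx i (Finset.mem_insert_of_mem hi) j (Finset.mem_insert_of_mem hj)
    by_cases ha : x a *ᵥ v = 0
    · exact ⟨v, hv, Finset.forall_mem_insert _ _ _ |>.mpr ⟨ha, hs⟩⟩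
    · refine ⟨x a *ᵥ v, ha, Finset.forall_mem_insert _ _ _ |>.mpr ⟨?_, fun i hi => ?_⟩⟩
      · have h : x a * x a = 0 := by
          have := hx a (Finset.mem_insert_self a s) a (Finset.mem_insert_self a s)
          ext i j
          have := congrFun (congrFun this i) j
          rw [Matrix.neg_apply] at this
          exact self_eq_neg.mp this
        rw [Matrix.mulVec_mulVec, h, Matrix.zero_mulVec]
      · rw [Matrix.mulVec_mulVec, hx i (Finset.mem_insert_of_mem hi) a (Finset.mem_insert_self a s),
          Matrix.neg_mulVec, ← Matrix.mulVec_mulVec, hs i hi, Matrix.mulVec_zero, neg_zero]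

lemma exists_normalized {m : Type*} [Fintype m] {v : m → ℂ} (hv : v ≠ 0) :
    ∃ c : ℂ, star (c • v) ⬝ᵥ (c • v) = 1 := by
  have h : star v ⬝ᵥ v = ((∑ i, ‖v i‖ ^ 2 : ℝ) : ℂ) := by
    simp only [dotProduct, Pi.star_apply]
    push_cast
    exact Finset.sum_congr rfl fun i _ => Complex.conj_mul' (v i)
  have hpos : 0 < ∑ i, ‖v i‖ ^ 2 := by
    obtain ⟨i, hi⟩ := Function.ne_iff.mp hv
    have : 0 < ‖v i‖ ^ 2 := by
      have := norm_pos_iff.mpr hi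
      positivity
    exact this.trans_le (Finset.single_le_sum (f := fun i => ‖v i‖ ^ 2)
      (fun i _ => by positivity) (Finset.mem_univ i))
  refine ⟨((1 / √(∑ i, ‖v i‖ ^ 2) : ℝ) : ℂ), ?_⟩
  rw [star_smul, smul_dotProduct, dotProduct_smul, h]
  simp only [RCLike.star_def, Complex.conj_ofReal, smul_eq_mul]
  norm_cast
  have := Real.mul_self_sqrt hpos.le
  have h0 : √(∑ i, ‖v i‖ ^ 2) ≠ 0 := (Real.sqrt_pos.mpr hpos).ne'
  field_simp
  linarith

/-- A ground state of the excitations: the eigenvalue `γ / 4` of `∂H/∂Δ`. -/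
lemma exists_top_eigenvector (κ : ℝ → ℝ) (hev : Even N) (J μ Δ : ℝ) :
    ∃ v : Finset (Fin N) → ℂ, star v ⬝ᵥ v = 1 ∧
      dHamiltonian κ N J μ Δ *ᵥ v = ((gammaSum κ N / 4 : ℝ) : ℂ) • v := by
  obtain ⟨v, hv, h⟩ := exists_common_kernel (excitation κ N) (Finset.range N) fun i hi j hj =>
    excitation_mul_excitation κ (Finset.mem_range.mp hi) (Finset.mem_range.mp hj)
  obtain ⟨c, hc⟩ := exists_normalized hv
  refine ⟨c • v, hc, ?_⟩
  rw [Matrix.mulVec_smul, smul_comm, dHamiltonian_eq_sub κ hev, Matrix.sub_mulVec,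
    Matrix.smul_mulVec, Matrix.smul_mulVec, Matrix.one_mulVec, Matrix.sum_mulVec,
    Finset.sum_eq_zero, smul_zero, sub_zero]
  intro n hn
  rw [Matrix.smul_mulVec, ← Matrix.mulVec_mulVec, h n hn, Matrix.mulVec_zero, smul_zero]

/-- The state with all excitations occupied: the eigenvalue `-γ / 4` of `∂H/∂Δ`. -/
lemma exists_bot_eigenvector (κ : ℝ → ℝ) (hev : Even N) (J μ Δ : ℝ) :
    ∃ v : Finset (Fin N) → ℂ, star v ⬝ᵥ v = 1 ∧
      dHamiltonian κ N J μ Δ *ᵥ v = -((gammaSum κ N / 4 : ℝ) : ℂ) • v := by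
  obtain ⟨v, hv, h⟩ := exists_common_kernel (fun n => (excitation κ N n)ᴴ) (Finset.range N)
    fun i hi j hj => by
      rw [← Matrix.conjTranspose_mul, excitation_mul_excitation κ (Finset.mem_range.mp hj)
        (Finset.mem_range.mp hi), Matrix.conjTranspose_neg, Matrix.conjTranspose_mul]
  obtain ⟨c, hc⟩ := exists_normalized hv
  refine ⟨c • v, hc, ?_⟩
  rw [Matrix.mulVec_smul, smul_comm _ c, dHamiltonian_eq_add κ hev, Matrix.add_mulVec,
    Matrix.smul_mulVec, Matrix.smul_mulVec, Matrix.one_mulVec, Matrix.sum_mulVec,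
    Finset.sum_eq_zero, smul_zero, add_zero]
  intro n hn
  rw [Matrix.smul_mulVec, ← Matrix.mulVec_mulVec, h n hn, Matrix.mulVec_zero, smul_zero]

open scoped Matrix.Norms.L2Operator in
/-- The operator norm of `∂H/∂Δ` is at most `γ / 4`. -/
lemma norm_dHamiltonian_le (κ : ℝ → ℝ) (hev : Even N) (J μ Δ : ℝ) :
    ‖dHamiltonian κ N J μ Δ‖ ≤ gammaSum κ N / 4 := by
  -- each `2 η† η - 1` is a Hermitian involution
  have hu : ∀ n ∈ Finset.range N, ‖(2 : ℂ) • ((mode N n)ᴴ * mode N n) - 1‖ ≤ 1 := by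
    intro n hn
    have h := mode_mul_mode_conjTranspose (Finset.mem_range.mp hn) (Finset.mem_range.mp hn)
    rw [if_pos rfl] at h
    set e := mode N n
    have hee : e * e = 0 := by
      have := mode_mul_mode (N := N) n n
      ext i j
      have := congrFun (congrFun this i) j
      rw [Matrix.neg_apply] at this
      exact self_eq_neg.mp this
    have hp : (eᴴ * e) * (eᴴ * e) = eᴴ * e := by
      rw [mul_assoc, ← mul_assoc e, eq_sub_of_add_eq h, sub_mul, mul_assoc eᴴ e e, hee, mul_zero,
        one_mul, sub_zero]
    have hsq : ((2 : ℂ) • (eᴴ * e) - 1) * ((2 : ℂ) • (eᴴ * e) - 1) = 1 := by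
      simp only [sub_mul, mul_sub, Matrix.smul_mul, Matrix.mul_smul, hp, one_mul, mul_one]
      module
    have hst : star ((2 : ℂ) • (eᴴ * e) - 1) = (2 : ℂ) • (eᴴ * e) - 1 := by
      rw [Matrix.star_eq_conjTranspose]
      simp
    exact (CStarRing.norm_of_mem_unitary
      (Unitary.mem_iff.mpr ⟨by rw [hst, hsq], by rw [hst, hsq]⟩)).le
  have hD : dHamiltonian κ N J μ Δ = ∑ n ∈ Finset.range N,
      ((dispersion κ N (momentum N n) / 4 : ℝ) : ℂ) • ((2 : ℂ) • ((mode N n)ᴴ * mode N n) - 1) := by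
    simp only [smul_sub, Finset.sum_sub_distrib, ← Finset.sum_smul, ← Complex.ofReal_sum,
      ← Finset.sum_div, sum_dispersion_momentum]
    rw [dHamiltonian_eq, pairing_eq_sum_mode κ hev, Finset.smul_sum]
    simp only [smul_smul, zero_div, Complex.ofReal_zero, zero_smul, sub_zero]
    refine Finset.sum_congr rfl fun n _ => ?_
    congr 1
    push_cast
    ring
  rw [hD, gammaSum_eq, Finset.sum_div]
  refine (norm_sum_le _ _).trans (Finset.sum_le_sum fun n hn => ?_)
  rw [norm_smul, Complex.norm_real, Real.norm_eq_abs, abs_div, abs_of_pos (by norm_num : (0:ℝ) < 4)]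
  exact mul_le_of_le_one_right (by positivity) (hu n hn)

/-! ### The optimal quantum Fisher information -/

/-- The evolution generated by a Hermitian Hamiltonian is unitary. -/
lemma IsEvolution.conjTranspose_mul_self {T : ℝ} {H U : ℝ → FockOp N} (hU : IsEvolution T H U)
    (hH : ∀ t ∈ Set.Icc 0 T, (H t).IsHermitian) {t : ℝ} (ht : t ∈ Set.Icc 0 T) :
    (U t)ᴴ * U t = 1 := by
  ext R S
  have hd : ∀ s ∈ Set.Icc 0 T,
      HasDerivWithinAt (fun s => ((U s)ᴴ * U s) R S) 0 (Set.Icc 0 T) s := by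
    intro s hs
    have h1 : HasDerivWithinAt (fun s => ∑ M, star (U s M R) * U s M S)
        (∑ M, (star (-Complex.I * (H s * U s) M R) * U s M S
          + star (U s M R) * (-Complex.I * (H s * U s) M S))) (Set.Icc 0 T) s :=
      HasDerivWithinAt.fun_sum fun M _ =>
        ((hU.schrodinger s hs M R).star).mul (hU.schrodinger s hs M S)
    have h2 : ∑ M, (star (-Complex.I * (H s * U s) M R) * U s M S
          + star (U s M R) * (-Complex.I * (H s * U s) M S)) = 0 := by
      have e1 : ∑ M, star ((H s * U s) M R) * U s M S = ((H s * U s)ᴴ * U s) R S := rfl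
      have e2 : ∑ M, star (U s M R) * (H s * U s) M S = ((U s)ᴴ * (H s * U s)) R S := rfl
      have e3 : (H s * U s)ᴴ * U s = (U s)ᴴ * (H s * U s) := by
        rw [Matrix.conjTranspose_mul, (hH s hs).eq, mul_assoc]
      calc _ = Complex.I * ∑ M, star ((H s * U s) M R) * U s M S
            - Complex.I * ∑ M, star (U s M R) * (H s * U s) M S := by
            rw [Finset.mul_sum, Finset.mul_sum, ← Finset.sum_sub_distrib]
            refine Finset.sum_congr rfl fun M _ => ?_
            simp only [star_mul', star_neg, RCLike.star_def, Complex.conj_I]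
            ring
        _ = 0 := by rw [e1, e2, e3, sub_self]
    rw [h2] at h1
    exact h1
  have := constant_of_has_deriv_right_zero (fun s hs => (hd s hs).continuousWithinAt)
    (fun s hs => (hd s ⟨hs.1, hs.2.le⟩).mono_of_mem_nhdsWithin
      (Icc_mem_nhdsGE_of_mem hs)) t ht
  rw [this, hU.init]
  simp

open scoped Matrix.Norms.L2Operator in
/-- The operator norm of the generator is at most `T` times that of `∂H/∂Δ`. -/
lemma norm_generator_le {T : ℝ} (hT : 0 < T) {H U : ℝ → FockOp N} (hU : IsEvolution T H U)
    (hH : ∀ t ∈ Set.Icc 0 T, (H t).IsHermitian) (D : FockOp N) :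
    ‖generator T D U‖ ≤ ‖D‖ * T := by
  have hc : ContinuousOn U (Set.Icc 0 T) :=
    continuousOn_pi.mpr fun R => continuousOn_pi.mpr fun S t ht =>
      (hU.schrodinger t ht R S).continuousWithinAt
  have hc2 : ContinuousOn (fun τ => (U τ)ᴴ * D * U τ) (Set.Icc 0 T) := by
    have : ContinuousOn (fun τ => (U τ)ᴴ) (Set.Icc 0 T) :=
      (continuous_id.matrix_conjTranspose).comp_continuousOn hc
    exact (this.mul continuousOn_const).mul hc
  have hi : IntervalIntegrable (fun τ => (U τ)ᴴ * D * U τ) MeasureTheory.volume 0 T :=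
    ContinuousOn.intervalIntegrable (by rwa [Set.uIcc_of_le hT.le])
  have hG : generator T D U = ∫ τ in (0 : ℝ)..T, (U τ)ᴴ * D * U τ := by
    ext R S
    exact ContinuousLinearMap.intervalIntegral_comp_comm
      (LinearMap.toContinuousLinearMap (Matrix.entryLinearMap ℂ ℂ R S)) hi
  have hb : ∀ τ ∈ Set.uIoc 0 T, ‖(U τ)ᴴ * D * U τ‖ ≤ ‖D‖ := by
    intro τ hτ
    rw [Set.uIoc_of_le hT.le] at hτ
    have h1 := hU.conjTranspose_mul_self hH ⟨hτ.1.le, hτ.2⟩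
    have hm : U τ ∈ unitary (FockOp N) :=
      Unitary.mem_iff.mpr ⟨h1, mul_eq_one_comm.mp h1⟩
    have := CStarRing.norm_mul_mem_unitary ((U τ)ᴴ * D) hm
    rw [this]
    exact (CStarRing.norm_mem_unitary_mul D (Unitary.star_mem hm)).le
  have := intervalIntegral.norm_integral_le_of_norm_le_const hb
  rwa [← hG, sub_zero, abs_of_pos hT] at this

open scoped Matrix.Norms.L2Operator in
lemma expect_le_norm (A : FockOp N) {ψ : Finset (Fin N) → ℂ} (hψ : star ψ ⬝ᵥ ψ = 1) :
    expect A ψ ≤ ‖A‖ := by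
  have h1 : ‖(WithLp.toLp 2 ψ : EuclideanSpace ℂ (Finset (Fin N)))‖ = 1 := by
    have := inner_self_eq_norm_sq_to_K (𝕜 := ℂ)
      (WithLp.toLp 2 ψ : EuclideanSpace ℂ (Finset (Fin N)))
    rw [EuclideanSpace.inner_toLp_toLp, dotProduct_comm, hψ] at this
    have h2 : ‖(WithLp.toLp 2 ψ : EuclideanSpace ℂ (Finset (Fin N)))‖ ^ 2 = 1 := by
      exact Complex.ofReal_injective (by simpa using this.symm)
    exact (pow_eq_one_iff_of_nonneg (norm_nonneg _) two_ne_zero).mp h2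
  have h2 := Matrix.l2_opNorm_mulVec A (WithLp.toLp 2 ψ)
  rw [h1, mul_one] at h2
  have h3 : expect A ψ = RCLike.re (inner ℂ (WithLp.toLp 2 ψ : EuclideanSpace ℂ (Finset (Fin N)))
      (WithLp.toLp 2 (A *ᵥ ψ))) := by
    rw [EuclideanSpace.inner_toLp_toLp, dotProduct_comm]
    rfl
  rw [h3]
  refine (re_inner_le_norm _ _).trans ?_
  rw [h1, one_mul]
  exact h2

/-- The quantum Fisher information of any control and any initial state is at most the squared
spectral width of `∂H/∂Δ` times `T ^ 2`. -/
lemma attainableQFI_le (κ : ℝ → ℝ) (hev : Even N) (J μ Δ : ℝ) {T : ℝ} (hT : 0 < T) {I : ℝ}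
    (hI : I ∈ attainableQFI κ J μ Δ T N) : I ≤ (gammaSum κ N / 2) ^ 2 * T ^ 2 := by
  open scoped Matrix.Norms.L2Operator in
  obtain ⟨Hc, U, ψ, hHc, hU, hψ, rfl⟩ := hI
  have hG := norm_generator_le hT hU
    (fun t ht => (hamiltonian_isHermitian κ hev J μ Δ).add (hHc t ht)) (dHamiltonian κ N J μ Δ)
  set G := generator T (dHamiltonian κ N J μ Δ) U
  have h1 : ‖G‖ ≤ gammaSum κ N / 4 * T :=
    hG.trans (mul_le_mul_of_nonneg_right (norm_dHamiltonian_le κ hev J μ Δ) hT.le)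
  have h2 : expect (G * G) ψ ≤ (gammaSum κ N / 4 * T) * (gammaSum κ N / 4 * T) :=
    (expect_le_norm _ hψ).trans ((norm_mul_le G G).trans
      (mul_le_mul h1 h1 (norm_nonneg _) ((norm_nonneg _).trans h1)))
  unfold qfi
  nlinarith [sq_nonneg (expect G ψ)]

/-- The quantum Fisher information of the generator `T D` in the balanced superposition of
eigenvectors of `D` for the eigenvalues `lam` and `-lam`. -/
lemma exists_qfi_eq {D : FockOp N} (hD : D.IsHermitian) (lam T : ℝ) {v w : Finset (Fin N) → ℂ}
    (hv : star v ⬝ᵥ v = 1) (hw : star w ⬝ᵥ w = 1) (hDv : D *ᵥ v = (lam : ℂ) • v)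
    (hDw : D *ᵥ w = -(lam : ℂ) • w) :
    ∃ ψ : Finset (Fin N) → ℂ, star ψ ⬝ᵥ ψ = 1 ∧ qfi ((T : ℂ) • D) ψ = 4 * (lam * T) ^ 2 := by
  rcases eq_or_ne lam 0 with rfl | hl
  · refine ⟨v, hv, ?_⟩
    have : ((T : ℂ) • D) *ᵥ v = 0 := by rw [Matrix.smul_mulVec, hDv]; simp
    rw [qfi, expect, expect, ← Matrix.mulVec_mulVec, this]
    simp
  have horth : star w ⬝ᵥ v = 0 := by
    have h1 : star w ⬝ᵥ (D *ᵥ v) = star (D *ᵥ w) ⬝ᵥ v := by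
      rw [Matrix.star_mulVec, hD.eq, Matrix.dotProduct_mulVec]
    rw [hDv, hDw, dotProduct_smul, star_smul, smul_dotProduct] at h1
    simp only [smul_eq_mul, star_neg, RCLike.star_def, Complex.conj_ofReal] at h1
    have h2 : (2 * (lam : ℂ)) * (star w ⬝ᵥ v) = 0 := by linear_combination h1
    have hl' : (2 * (lam : ℂ)) ≠ 0 := by simpa using hl
    exact (mul_eq_zero.mp h2).resolve_left hl'
  have horth' : star v ⬝ᵥ w = 0 := by
    have := congrArg star horth
    rwa [Matrix.star_dotProduct, star_star, star_zero] at this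
  have hs : ((1 / √2 : ℝ) : ℂ) * ((1 / √2 : ℝ) : ℂ) = 1 / 2 := by
    norm_cast
    rw [div_mul_div_comm, Real.mul_self_sqrt (by norm_num)]
    norm_num
  set c : ℂ := ((1 / √2 : ℝ) : ℂ) with hc
  have hcs : star c = c := Complex.conj_ofReal _
  have hG1 : ((T : ℂ) • D) *ᵥ (c • (v + w)) = (T * lam * c : ℂ) • (v - w) := by
    rw [Matrix.smul_mulVec, Matrix.mulVec_smul, Matrix.mulVec_add, hDv, hDw]
    module
  have hG2 : ((T : ℂ) • D) *ᵥ (v - w) = (T * lam : ℂ) • (v + w) := by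
    rw [Matrix.smul_mulVec, Matrix.mulVec_sub, hDv, hDw]
    module
  refine ⟨c • (v + w), ?_, ?_⟩
  · simp only [star_smul, star_add, smul_dotProduct, dotProduct_smul, add_dotProduct,
      dotProduct_add, hv, hw, horth, horth', hcs, smul_eq_mul]
    linear_combination 2 * hs
  · have e1 : expect ((T : ℂ) • D) (c • (v + w)) = 0 := by
      rw [expect, hG1]
      simp [star_smul, smul_dotProduct, dotProduct_smul, add_dotProduct, dotProduct_sub, hv, hw,
        horth, horth']
    have e2 : expect (((T : ℂ) • D) * ((T : ℂ) • D)) (c • (v + w)) = (lam * T) ^ 2 := by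
      rw [expect, ← Matrix.mulVec_mulVec, hG1, Matrix.mulVec_smul, hG2]
      simp only [star_smul, star_add, smul_dotProduct, dotProduct_smul, add_dotProduct,
        dotProduct_add, hv, hw, horth, horth', hcs, smul_eq_mul]
      rw [← Complex.ofReal_re ((lam * T) ^ 2)]
      congr 1
      push_cast
      linear_combination 2 * (T : ℂ) ^ 2 * lam ^ 2 * hs
    rw [qfi, e1, e2]
    ring

/-- With the control `-H` the system does not evolve, and the generator is `T ∂H/∂Δ`. -/
lemma mem_attainableQFI (κ : ℝ → ℝ) (hev : Even N) (J μ Δ T : ℝ) :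
    (gammaSum κ N / 2) ^ 2 * T ^ 2 ∈ attainableQFI κ J μ Δ T N := by
  obtain ⟨v, hv, hDv⟩ := exists_top_eigenvector κ hev J μ Δ
  obtain ⟨w, hw, hDw⟩ := exists_bot_eigenvector κ hev J μ Δ
  obtain ⟨ψ, hψ, hq⟩ := exists_qfi_eq (dHamiltonian_isHermitian κ hev J μ Δ) _ T hv hw hDv hDw
  refine ⟨fun _ => -hamiltonian κ N J μ Δ, fun _ => 1, ψ,
    fun _ _ => (hamiltonian_isHermitian κ hev J μ Δ).neg, ⟨rfl, ?_⟩, hψ, ?_⟩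
  · intro t _ R S
    simpa using hasDerivWithinAt_const t (Set.Icc 0 T) ((1 : FockOp N) R S)
  · have : generator T (dHamiltonian κ N J μ Δ) (fun _ => 1) = (T : ℂ) • dHamiltonian κ N J μ Δ := by
      ext R S
      simp [generator]
    rw [this, hq]
    ring

theorem isGreatest_attainableQFI (κ : ℝ → ℝ) (hev : Even N) (J μ Δ : ℝ) {T : ℝ} (hT : 0 < T) :
    IsGreatest (attainableQFI κ J μ Δ T N) ((gammaSum κ N / 2) ^ 2 * T ^ 2) :=
  ⟨mem_attainableQFI κ hev J μ Δ T, fun _ hI => attainableQFI_le κ hev J μ Δ hT hI⟩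

theorem optimalQFI_eq (κ : ℝ → ℝ) (hev : Even N) (J μ Δ : ℝ) {T : ℝ} (hT : 0 < T) :
    optimalQFI κ J μ Δ T N = (gammaSum κ N / 2) ^ 2 * T ^ 2 :=
  (isGreatest_attainableQFI κ hev J μ Δ hT).csSup_eq

/-! ### Bounds on the sum of the dispersion function over the momenta -/

lemma gammaSum_nonneg (κ : ℝ → ℝ) (N : ℕ) : 0 ≤ gammaSum κ N :=
  Finset.sum_nonneg fun _ _ => abs_nonneg _

lemma gammaSum_add_le (κ₁ κ₂ : ℝ → ℝ) (N : ℕ) :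
    gammaSum (fun x => κ₁ x + κ₂ x) N ≤ gammaSum κ₁ N + gammaSum κ₂ N := by
  simp only [gammaSum_eq, ← Finset.sum_add_distrib]
  refine Finset.sum_le_sum fun n _ => le_trans (le_of_eq ?_) (abs_add_le _ _)
  simp only [dispersion, add_mul, Finset.sum_add_distrib]
  congr 1
  ring

lemma gammaSum_neg (κ : ℝ → ℝ) (N : ℕ) : gammaSum (fun x => -κ x) N = gammaSum κ N := by
  simp only [gammaSum_eq]
  refine Finset.sum_congr rfl fun n _ => ?_
  rw [← abs_neg]
  simp only [dispersion, neg_mul, Finset.sum_neg_distrib]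
  congr 1
  ring

/-- The discrete Fourier sine coefficients of the sawtooth function `π - k` are positive. -/
lemma sum_sawtooth_mul_sin (hN : 0 < N) {l : ℕ} (hl : 0 < l) (hlN : l < N) :
    ∑ n ∈ Finset.range N, (Real.pi - momentum N n) * Real.sin (momentum N n * l) =
      Real.pi / Real.sin (Real.pi * l / N) := by
  have hN0 : (0 : ℝ) < N := by exact_mod_cast hN
  set θ : ℝ := Real.pi * l / N with hθ
  have hsin : 0 < Real.sin θ := by
    apply Real.sin_pos_of_pos_of_lt_pi
    · have : (0 : ℝ) < l := by exact_mod_cast hl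
      positivity
    · rw [hθ, div_lt_iff₀ hN0]
      have : (l : ℝ) < N := by exact_mod_cast hlN
      exact mul_lt_mul_of_pos_left this Real.pi_pos
  have hk : ∀ n : ℕ, momentum N n * l = (2 * n + 1) * θ := fun n => by
    rw [momentum, hθ]; ring
  -- summation by parts, after multiplication by `2 sin θ`
  have habel : ∀ M : ℕ, ∑ n ∈ Finset.range M,
      (2 * (n : ℝ) + 1) * (2 * Real.sin θ * Real.sin ((2 * n + 1) * θ)) =
      2 * ∑ n ∈ Finset.range M, Real.cos (2 * n * θ) - 1 - (2 * M - 1) * Real.cos (2 * M * θ) := by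
    intro M
    induction M with
    | zero => simp
    | succ M ih =>
      rw [Finset.sum_range_succ, ih, Finset.sum_range_succ]
      have h1 : Real.cos (2 * M * θ) =
          Real.cos ((2 * M + 1) * θ) * Real.cos θ + Real.sin ((2 * M + 1) * θ) * Real.sin θ := by
        rw [← Real.cos_sub]; congr 1; ring
      have h2 : Real.cos (2 * ((M + 1 : ℕ) : ℝ) * θ) =
          Real.cos ((2 * M + 1) * θ) * Real.cos θ - Real.sin ((2 * M + 1) * θ) * Real.sin θ := by
        rw [← Real.cos_add]; congr 1; push_cast; ring
      rw [h2]
      push_cast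
      linear_combination (-(2 * (M : ℝ) + 1)) * h1
  have hcos : ∑ n ∈ Finset.range N, Real.cos (2 * n * θ) = 0 := by
    have hnd : ¬ (N : ℤ) ∣ (l : ℤ) := by
      rw [Int.natCast_dvd_natCast]
      exact Nat.not_dvd_of_pos_of_lt hl hlN
    rw [← sum_cos_eq_zero hN hnd]
    refine Finset.sum_congr rfl fun n _ => ?_
    rw [hθ]; push_cast; congr 1; ring
  have hcosN : Real.cos (2 * N * θ) = 1 := by
    rw [show 2 * (N : ℝ) * θ = l * (2 * Real.pi) by rw [hθ]; field_simp]
    exact Real.cos_nat_mul_two_pi l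
  have h0 : ∑ n ∈ Finset.range N, Real.sin (momentum N n * l) = 0 :=
    sum_momentum_eq_zero_of_odd hN (fun k => Real.sin (k * l)) fun k => sin_two_pi_sub_mul k l
  have h1 := habel N
  rw [hcos, hcosN] at h1
  have h2 : ∑ n ∈ Finset.range N, (2 * (n : ℝ) + 1) * (2 * Real.sin θ * Real.sin ((2 * n + 1) * θ))
      = 2 * Real.sin θ * (N / Real.pi) *
        ∑ n ∈ Finset.range N, momentum N n * Real.sin (momentum N n * l) := by
    rw [Finset.mul_sum]
    refine Finset.sum_congr rfl fun n _ => ?_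
    rw [hk n, momentum]
    have := Real.pi_ne_zero
    field_simp
  rw [h2] at h1
  simp only [sub_mul, Finset.sum_sub_distrib, ← Finset.mul_sum, h0]
  have hpi := Real.pi_ne_zero
  generalize ∑ n ∈ Finset.range N, momentum N n * Real.sin (momentum N n * l) = X at h1 ⊢
  field_simp at h1 ⊢
  have h3 : (N : ℝ) * (Real.sin θ * X) = N * (-Real.pi) := by
    linear_combination h1 / 2
  have := mul_left_cancel₀ hN0.ne' h3
  linear_combination -this

/-- Testing `f` against the sawtooth function bounds `γ(N)` from below. -/
lemma le_gammaSum (κ : ℝ → ℝ) (hN : 0 < N) (hev : Even N) :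
    ∑ l ∈ Finset.Ico 1 N, kappaSymm κ N l / Real.sin (Real.pi * l / N) ≤ gammaSum κ N := by
  have h : ∑ n ∈ Finset.range N, (Real.pi - momentum N n) * dispersion κ N (momentum N n) =
      Real.pi * ∑ l ∈ Finset.Ico 1 N, kappaSymm κ N l / Real.sin (Real.pi * l / N) := by
    simp only [dispersion_momentum κ hN hev, Finset.mul_sum]
    rw [Finset.sum_comm]
    refine Finset.sum_congr rfl fun l hl => ?_
    rw [Finset.mem_Ico] at hl
    rw [mul_div_left_comm, ← sum_sawtooth_mul_sin hN (by omega) hl.2, Finset.mul_sum]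
    exact Finset.sum_congr rfl fun n _ => by ring
  rw [← mul_le_mul_iff_right₀ Real.pi_pos, ← h, gammaSum_eq, Finset.mul_sum]
  refine Finset.sum_le_sum fun n hn => (le_abs_self _).trans ?_
  rw [abs_mul]
  refine mul_le_mul_of_nonneg_right ?_ (abs_nonneg _)
  have hN0 : (0 : ℝ) < N := by exact_mod_cast hN
  have hn' : ((n : ℝ) + 1) ≤ N := by exact_mod_cast Finset.mem_range.mp hn
  have h1 : 0 ≤ momentum N n := by unfold momentum; positivity
  have h2 : momentum N n ≤ 2 * Real.pi := by
    rw [momentum, div_le_iff₀ hN0]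
    nlinarith [Real.pi_pos]
  rw [abs_le]
  constructor <;> linarith

/-- For nonnegative couplings, `γ(N)` is at least of the order of `N` times their harmonic sum. -/
lemma harmonic_le_gammaSum (κ : ℝ → ℝ) (hN : 0 < N) (hev : Even N)
    (hκ : ∀ l : ℕ, 1 ≤ l → 0 ≤ κ l) :
    N / Real.pi * ∑ l ∈ Finset.Icc 1 (N / 2), κ l / l ≤ gammaSum κ N := by
  refine le_trans ?_ (le_gammaSum κ hN hev)
  have hN0 : (0 : ℝ) < N := by exact_mod_cast hN
  have hsin : ∀ l ∈ Finset.Ico 1 N, 0 < Real.sin (Real.pi * l / N) := by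
    intro l hl
    rw [Finset.mem_Ico] at hl
    have h1 : (0 : ℝ) < l := by exact_mod_cast hl.1
    have h2 : (l : ℝ) < N := by exact_mod_cast hl.2
    apply Real.sin_pos_of_pos_of_lt_pi
    · have := Real.pi_pos
      positivity
    · rw [div_lt_iff₀ hN0]
      exact mul_lt_mul_of_pos_left h2 Real.pi_pos
  have hsub : Finset.Icc 1 (N / 2) ⊆ Finset.Ico 1 N := by
    intro l hl
    rw [Finset.mem_Icc] at hl
    rw [Finset.mem_Ico]
    omega
  have hK : ∀ l ∈ Finset.Ico 1 N, 0 ≤ kappaSymm κ N l := by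
    intro l hl
    rw [Finset.mem_Ico] at hl
    exact hκ _ (by omega)
  refine le_trans ?_ (Finset.sum_le_sum_of_subset_of_nonneg hsub
    fun l hl _ => div_nonneg (hK l hl) (hsin l hl).le)
  rw [Finset.mul_sum]
  refine Finset.sum_le_sum fun l hl => ?_
  have h1 := hsin l (hsub hl)
  have h2 := hK l (hsub hl)
  rw [Finset.mem_Icc] at hl
  have h3 : kappaSymm κ N l = κ l := by rw [kappaSymm, min_eq_left (by omega)]
  have hl0 : (0 : ℝ) < l := by exact_mod_cast hl.1
  have hpi := Real.pi_pos
  rw [h3] at h2 ⊢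
  calc N / Real.pi * (κ l / l) = κ l / (Real.pi * l / N) := by field_simp
    _ ≤ κ l / Real.sin (Real.pi * l / N) :=
      div_le_div_of_nonneg_left h2 h1 (Real.sin_le (by positivity))

/-- Abel's inequality. -/
lemma abs_sum_mul_le {g z : ℕ → ℝ} {B : ℝ} (hg : Antitone g) (hg0 : ∀ i, 0 ≤ g i)
    (hz : ∀ m, |∑ i ∈ Finset.range m, z i| ≤ B) (m : ℕ) :
    |∑ i ∈ Finset.range m, g i * z i| ≤ g 0 * B := by
  have h1 : ∀ m, ∑ i ∈ Finset.range m, g i * z i = g m * ∑ i ∈ Finset.range m, z i +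
      ∑ i ∈ Finset.range m, (g i - g (i + 1)) * ∑ j ∈ Finset.range (i + 1), z j := by
    intro m
    induction m with
    | zero => simp
    | succ m ih =>
      rw [Finset.sum_range_succ, ih, Finset.sum_range_succ (fun i => (g i - g (i + 1)) *
        ∑ j ∈ Finset.range (i + 1), z j), Finset.sum_range_succ z]
      ring
  rw [h1]
  calc _ ≤ |g m * ∑ i ∈ Finset.range m, z i| +
        ∑ i ∈ Finset.range m, |(g i - g (i + 1)) * ∑ j ∈ Finset.range (i + 1), z j| :=
        (abs_add_le _ _).trans (add_le_add_right (Finset.abs_sum_le_sum_abs _ _) _)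
    _ ≤ g m * B + ∑ i ∈ Finset.range m, (g i - g (i + 1)) * B := by
        refine add_le_add ?_ (Finset.sum_le_sum fun i _ => ?_)
        · rw [abs_mul, abs_of_nonneg (hg0 m)]
          exact mul_le_mul_of_nonneg_left (hz m) (hg0 m)
        · have : 0 ≤ g i - g (i + 1) := sub_nonneg.mpr (hg (Nat.le_succ i))
          rw [abs_mul, abs_of_nonneg this]
          exact mul_le_mul_of_nonneg_left (hz _) this
    _ = g 0 * B := by
        rw [← Finset.sum_mul, Finset.sum_range_sub']
        ring

lemma abs_sum_sin_le {k : ℝ} (hk : 0 < k) (hk' : k ≤ Real.pi) (a m : ℕ) :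
    |∑ i ∈ Finset.range m, Real.sin (k * ((a + i : ℕ) : ℝ))| ≤ Real.pi / k := by
  have htel : ∀ m : ℕ, 2 * Real.sin (k / 2) * ∑ i ∈ Finset.range m,
      Real.sin (k * ((a + i : ℕ) : ℝ)) =
      Real.cos (k * a - k / 2) - Real.cos (k * (a + m) - k / 2) := by
    intro m
    induction m with
    | zero => simp
    | succ m ih =>
      rw [Finset.sum_range_succ, mul_add, ih]
      have h1 : Real.cos (k * (a + m) - k / 2) = Real.cos (k * ((a + m : ℕ) : ℝ)) *
          Real.cos (k / 2) + Real.sin (k * ((a + m : ℕ) : ℝ)) * Real.sin (k / 2) := by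
        rw [← Real.cos_sub]; push_cast; rfl
      have h2 : Real.cos (k * (a + (m + 1 : ℕ)) - k / 2) = Real.cos (k * ((a + m : ℕ) : ℝ)) *
          Real.cos (k / 2) - Real.sin (k * ((a + m : ℕ) : ℝ)) * Real.sin (k / 2) := by
        rw [← Real.cos_add]; push_cast; congr 1; ring
      rw [h1, h2]
      ring
  have hs : k / Real.pi ≤ Real.sin (k / 2) := by
    have := Real.mul_le_sin (x := k / 2) (by linarith) (by linarith)
    calc k / Real.pi = 2 / Real.pi * (k / 2) := by ring
      _ ≤ _ := this
  have hpos : 0 < k / Real.pi := div_pos hk Real.pi_pos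
  have h2 : 2 * Real.sin (k / 2) * |∑ i ∈ Finset.range m, Real.sin (k * ((a + i : ℕ) : ℝ))| ≤ 2 := by
    have h0 : 0 ≤ 2 * Real.sin (k / 2) := by linarith
    rw [← abs_of_nonneg h0, ← abs_mul, htel, abs_le]
    constructor <;>
      linarith [Real.cos_le_one (k * a - k / 2), Real.neg_one_le_cos (k * a - k / 2),
        Real.cos_le_one (k * (a + m) - k / 2), Real.neg_one_le_cos (k * (a + m) - k / 2)]
  set A := |∑ i ∈ Finset.range m, Real.sin (k * ((a + i : ℕ) : ℝ))|
  have h3 : k / Real.pi * A ≤ 1 := by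
    have : k / Real.pi * A ≤ Real.sin (k / 2) * A := mul_le_mul_of_nonneg_right hs (abs_nonneg _)
    linarith
  rw [le_div_iff₀ hk]
  rw [div_mul_eq_mul_div, div_le_one Real.pi_pos] at h3
  linarith

/-- Sine sums with nonnegative, nonincreasing coefficients are dominated by the coefficients with
index at most `π / k`. -/
lemma abs_sum_mul_sin_momentum_le (κ : ℝ → ℝ) (hanti : AntitoneOn κ (Set.Ici 1))
    (hκ : ∀ x ∈ Set.Ici (1 : ℝ), 0 ≤ κ x) {n : ℕ} (hn : n < N / 2) {m : ℕ} (hm : m ≤ N / 2) :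
    |∑ l ∈ Finset.Icc 1 m, κ l * Real.sin (momentum N n * l)| ≤
      3 * ∑ l ∈ (Finset.Icc 1 (N / 2)).filter (fun l => (2 * n + 1) * l ≤ N), κ l := by
  have hN : 0 < N := by omega
  have hN0 : (0 : ℝ) < N := by exact_mod_cast hN
  have hκ' : ∀ l : ℕ, 1 ≤ l → 0 ≤ κ l := fun l hl => hκ _ (by simpa using hl)
  set q := N / (2 * n + 1) with hq
  have hq1 : 1 ≤ q := (Nat.one_le_div_iff (by omega)).mpr (by omega)
  have hql : ∀ l, l ≤ q ↔ (2 * n + 1) * l ≤ N := fun l => by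
    rw [hq, Nat.le_div_iff_mul_le (by omega), mul_comm]
  -- the head of the series, bounded term by term
  have hhead : ∀ p, p ≤ q → p ≤ N / 2 →
      |∑ l ∈ Finset.Icc 1 p, κ l * Real.sin (momentum N n * l)| ≤
      ∑ l ∈ (Finset.Icc 1 (N / 2)).filter (fun l => (2 * n + 1) * l ≤ N), κ l := by
    intro p hp hp2
    have hsub : Finset.Icc 1 p ⊆
        (Finset.Icc 1 (N / 2)).filter (fun l => (2 * n + 1) * l ≤ N) := by
      intro l hl
      rw [Finset.mem_Icc] at hl
      rw [Finset.mem_filter, Finset.mem_Icc, ← hql]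
      omega
    refine (Finset.abs_sum_le_sum_abs _ _).trans (le_trans (Finset.sum_le_sum fun l hl => ?_)
      (Finset.sum_le_sum_of_subset_of_nonneg hsub fun l hl _ => hκ' l ?_))
    · rw [Finset.mem_Icc] at hl
      rw [abs_mul, abs_of_nonneg (hκ' l hl.1)]
      exact mul_le_of_le_one_right (hκ' l hl.1) (Real.abs_sin_le_one _)
    · exact (Finset.mem_Icc.mp (Finset.mem_filter.mp hl).1).1
  have hS : 0 ≤ ∑ l ∈ (Finset.Icc 1 (N / 2)).filter (fun l => (2 * n + 1) * l ≤ N), κ l :=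
    (abs_nonneg _).trans (hhead 0 (by omega) (by omega))
  rcases le_or_gt m q with hmq | hmq
  · linarith [hhead m hmq hm]
  -- the tail of the series, bounded by Abel's inequality
  have hk : 0 < momentum N n := by unfold momentum; have := Real.pi_pos; positivity
  have hk' : momentum N n ≤ Real.pi := by
    rw [momentum, div_le_iff₀ hN0]
    have : (2 * (n : ℝ) + 1) ≤ N := by
      have : 2 * n + 1 ≤ N := by omega
      exact_mod_cast this
    nlinarith [Real.pi_pos]
  have hsplit : ∑ l ∈ Finset.Icc 1 m, κ l * Real.sin (momentum N n * l) =
      ∑ l ∈ Finset.Icc 1 q, κ l * Real.sin (momentum N n * l) +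
      ∑ i ∈ Finset.range (m - q), κ ((q + 1 + i : ℕ) : ℝ) *
        Real.sin (momentum N n * ((q + 1 + i : ℕ) : ℝ)) := by
    have e1 : ∀ p, Finset.Icc 1 p = Finset.Ico 1 (p + 1) := fun p => by ext; simp
    rw [e1, e1, ← Finset.sum_Ico_consecutive _ (show 1 ≤ q + 1 by omega)
      (show q + 1 ≤ m + 1 by omega), Finset.sum_Ico_eq_sum_range _ (q + 1),
      show m + 1 - (q + 1) = m - q by omega]
  have htail : |∑ i ∈ Finset.range (m - q), κ ((q + 1 + i : ℕ) : ℝ) *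
        Real.sin (momentum N n * ((q + 1 + i : ℕ) : ℝ))| ≤
      κ ((q + 1 + 0 : ℕ) : ℝ) * (Real.pi / momentum N n) := by
    refine abs_sum_mul_le (g := fun i => κ ((q + 1 + i : ℕ) : ℝ)) ?_ ?_
      (fun m => abs_sum_sin_le hk hk' (q + 1) m) (m - q)
    · intro i j hij
      refine hanti ?_ ?_ ?_
      · rw [Set.mem_Ici]; exact_mod_cast (by omega : 1 ≤ q + 1 + i)
      · rw [Set.mem_Ici]; exact_mod_cast (by omega : 1 ≤ q + 1 + j)
      · exact_mod_cast (by omega : q + 1 + i ≤ q + 1 + j)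
    · intro i
      exact hκ' _ (by omega)
  have hpk : Real.pi / momentum N n ≤ q + 1 := by
    have : N < (2 * n + 1) * (q + 1) := by
      by_contra h
      have := (hql (q + 1)).mpr (not_lt.mp h)
      omega
    have h' : (N : ℝ) < (2 * n + 1) * (q + 1) := by exact_mod_cast this
    rw [div_le_iff₀ hk, momentum, mul_div_assoc', le_div_iff₀ hN0]
    nlinarith [Real.pi_pos]
  have hq2 : κ ((q + 1 + 0 : ℕ) : ℝ) * (Real.pi / momentum N n) ≤
      2 * ∑ l ∈ Finset.Icc 1 q, κ l := by
    have h1 : ∀ l ∈ Finset.Icc 1 q, κ ((q + 1 + 0 : ℕ) : ℝ) ≤ κ l := by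
      intro l hl
      rw [Finset.mem_Icc] at hl
      refine hanti ?_ ?_ ?_
      · rw [Set.mem_Ici]; exact_mod_cast hl.1
      · rw [Set.mem_Ici]; exact_mod_cast (by omega : 1 ≤ q + 1 + 0)
      · exact_mod_cast (by omega : l ≤ q + 1 + 0)
    have h2 := Finset.card_nsmul_le_sum _ _ _ h1
    rw [Nat.card_Icc, Nat.add_sub_cancel, nsmul_eq_mul] at h2
    have h3 : 0 ≤ κ ((q + 1 + 0 : ℕ) : ℝ) := hκ' _ (by omega)
    have h4 : (1 : ℝ) ≤ q := by exact_mod_cast hq1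
    nlinarith
  have hq3 : ∑ l ∈ Finset.Icc 1 q, κ l ≤
      ∑ l ∈ (Finset.Icc 1 (N / 2)).filter (fun l => (2 * n + 1) * l ≤ N), κ l := by
    refine Finset.sum_le_sum_of_subset_of_nonneg ?_ fun l hl _ => hκ' l ?_
    · intro l hl
      rw [Finset.mem_Icc] at hl
      rw [Finset.mem_filter, Finset.mem_Icc, ← hql]
      omega
    · exact (Finset.mem_Icc.mp (Finset.mem_filter.mp hl).1).1
  rw [hsplit]
  have := abs_add_le (∑ l ∈ Finset.Icc 1 q, κ l * Real.sin (momentum N n * l))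
    (∑ i ∈ Finset.range (m - q), κ ((q + 1 + i : ℕ) : ℝ) *
        Real.sin (momentum N n * ((q + 1 + i : ℕ) : ℝ)))
  linarith [hhead q le_rfl (by omega)]

lemma dispersion_eq_add (κ : ℝ → ℝ) (hN : 0 < N) (hev : Even N) (k : ℝ) :
    dispersion κ N k = ∑ l ∈ Finset.Icc 1 (N / 2 - 1), κ l * Real.sin (k * l) +
      ∑ l ∈ Finset.Icc 1 (N / 2), κ l * Real.sin (k * l) := by
  obtain ⟨m, hm⟩ := hev
  have h : N / 2 = (N / 2 - 1) + 1 := by omega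
  rw [dispersion]
  conv_rhs => rw [h, Finset.sum_Icc_succ_top (by omega), Nat.add_sub_cancel, ← h]
  ring

/-- For nonnegative, nonincreasing couplings, `γ(N)` is at most of the order of `N` times their
harmonic sum: the coupling `κ_l` contributes only to the about `N / l` momenta with `k ≤ π / l`. -/
lemma gammaSum_le_harmonic (κ : ℝ → ℝ) (hanti : AntitoneOn κ (Set.Ici 1))
    (hκ : ∀ x ∈ Set.Ici (1 : ℝ), 0 ≤ κ x) (hN : 0 < N) (hev : Even N) :
    gammaSum κ N ≤ 12 * N * ∑ l ∈ Finset.Icc 1 (N / 2), κ l / l := by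
  have hκ' : ∀ l : ℕ, 1 ≤ l → 0 ≤ κ l := fun l hl => hκ _ (by simpa using hl)
  set M := N / 2 with hM
  have hNM : N = M + M := by obtain ⟨m, hm⟩ := hev; omega
  -- the momenta above `π` mirror those below
  have hhalf : gammaSum κ N = 2 * ∑ n ∈ Finset.range M, |dispersion κ N (momentum N n)| := by
    rw [gammaSum_eq]
    conv_lhs => rw [show Finset.range N = Finset.range (M + M) by rw [← hNM]]
    rw [Finset.sum_range_add, two_mul]
    congr 1
    rw [← Finset.sum_range_reflect]
    refine Finset.sum_congr rfl fun n hn => ?_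
    rw [Finset.mem_range] at hn
    rw [show M + (M - 1 - n) = N - 1 - n by omega, momentum_reflect hN (by omega),
      dispersion_two_pi_sub, abs_neg]
  have hn : ∀ n ∈ Finset.range M, |dispersion κ N (momentum N n)| ≤
      6 * ∑ l ∈ Finset.Icc 1 M, if (2 * n + 1) * l ≤ N then κ l else 0 := by
    intro n hn
    rw [Finset.mem_range] at hn
    rw [dispersion_eq_add κ hN hev, ← Finset.sum_filter]
    have h1 := abs_sum_mul_sin_momentum_le κ hanti hκ hn (m := N / 2 - 1) (by omega)
    have h2 := abs_sum_mul_sin_momentum_le κ hanti hκ hn (m := N / 2) le_rfl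
    have h3 := abs_add_le (∑ l ∈ Finset.Icc 1 (N / 2 - 1), κ l * Real.sin (momentum N n * l))
      (∑ l ∈ Finset.Icc 1 (N / 2), κ l * Real.sin (momentum N n * l))
    linarith
  rw [hhalf]
  have h1 := Finset.sum_le_sum hn
  rw [← Finset.mul_sum, Finset.sum_comm] at h1
  have h2 : ∑ l ∈ Finset.Icc 1 M, ∑ n ∈ Finset.range M,
      (if (2 * n + 1) * l ≤ N then κ l else 0) ≤ N * ∑ l ∈ Finset.Icc 1 M, κ l / l := by
    rw [Finset.mul_sum]
    refine Finset.sum_le_sum fun l hl => ?_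
    rw [Finset.mem_Icc] at hl
    have hl0 : (0 : ℝ) < l := by exact_mod_cast hl.1
    rw [← Finset.sum_filter, Finset.sum_const, nsmul_eq_mul]
    have hcard : ((Finset.range M).filter (fun n => (2 * n + 1) * l ≤ N)).card ≤ N / l := by
      rw [← Finset.card_range (N / l)]
      refine Finset.card_le_card fun n hn => ?_
      rw [Finset.mem_filter] at hn
      rw [Finset.mem_range, ← Nat.succ_le_iff, Nat.le_div_iff_mul_le (by omega)]
      refine le_trans ?_ hn.2
      exact Nat.mul_le_mul_right l (by omega)
    have hcard' : (((Finset.range M).filter (fun n => (2 * n + 1) * l ≤ N)).card : ℝ) ≤ N / l :=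
      (Nat.cast_le.mpr hcard).trans Nat.cast_div_le
    calc _ ≤ (N / l : ℝ) * κ l := mul_le_mul_of_nonneg_right hcard' (hκ' l hl.1)
      _ = N * (κ l / l) := by ring
  linarith

/-- Couplings of finite range contribute `O(N)` to `γ(N)`. -/
lemma gammaSum_le_of_finite_range (κ : ℝ → ℝ) {C : ℝ} {L : ℕ}
    (hC : ∀ l : ℕ, 1 ≤ l → |κ l| ≤ C) (hL : ∀ l : ℕ, 1 ≤ l → L ≤ l → κ l = 0) (hN : 0 < N)
    (hev : Even N) : gammaSum κ N ≤ 2 * L * C * N := by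
  have hC0 : 0 ≤ C := (abs_nonneg _).trans (hC 1 le_rfl)
  have hsum : ∀ (k : ℝ) (m : ℕ), |∑ l ∈ Finset.Icc 1 m, κ l * Real.sin (k * l)| ≤ L * C := by
    intro k m
    have h1 : ∀ l ∈ Finset.Icc 1 m, |κ l * Real.sin (k * l)| ≤
        if l ∈ Finset.range L then C else 0 := by
      intro l hl
      rw [Finset.mem_Icc] at hl
      split_ifs with h
      · rw [abs_mul]
        exact (mul_le_of_le_one_right (abs_nonneg _) (Real.abs_sin_le_one _)).trans (hC l hl.1)
      · rw [Finset.mem_range, not_lt] at h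
        simp [hL l hl.1 h]
    refine (Finset.abs_sum_le_sum_abs _ _).trans ((Finset.sum_le_sum h1).trans ?_)
    rw [← Finset.sum_filter, Finset.sum_const, nsmul_eq_mul]
    refine mul_le_mul_of_nonneg_right ?_ hC0
    rw [Nat.cast_le]
    conv_rhs => rw [← Finset.card_range L]
    exact Finset.card_le_card fun l hl => (Finset.mem_filter.mp hl).2
  rw [gammaSum_eq]
  calc _ ≤ ∑ _n ∈ Finset.range N, 2 * L * C := by
        refine Finset.sum_le_sum fun n _ => ?_
        rw [dispersion_eq_add κ hN hev]
        refine (abs_add_le _ _).trans ?_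
        linarith [hsum (momentum N n) (N / 2 - 1), hsum (momentum N n) (N / 2)]
    _ = _ := by
        rw [Finset.sum_const, nsmul_eq_mul, Finset.card_range]
        ring

/-! ### Comparison with the integral of the decay law -/

lemma evenAtTop_le : evenAtTop ≤ atTop := inf_le_left

lemma eventually_even : ∀ᶠ N in evenAtTop, Even N :=
  Filter.mem_inf_of_right (Filter.mem_principal_self _)

instance evenAtTop_neBot : evenAtTop.NeBot := by
  rw [evenAtTop, ← Filter.frequently_mem_iff_neBot, Filter.frequently_atTop]
  exact fun a => ⟨a + a, Nat.le_add_left a a, ⟨a, rfl⟩⟩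

lemma eventually_le_log (C : ℝ) : ∀ᶠ N : ℕ in evenAtTop, C ≤ Real.log N :=
  evenAtTop_le ((Real.tendsto_log_atTop.comp tendsto_natCast_atTop_atTop).eventually_ge_atTop C)

lemma eventually_ge (n : ℕ) : ∀ᶠ N : ℕ in evenAtTop, n ≤ N :=
  evenAtTop_le (eventually_ge_atTop n)

variable {κ : ℝ → ℝ}

lemma IsDecayLaw.le_one (hκ : IsDecayLaw κ) {x : ℝ} (hx : 1 ≤ x) : κ x ≤ 1 :=
  hκ.normalized ▸ hκ.antitone Set.self_mem_Ici hx hx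

lemma IsDecayLaw.intervalIntegrable (hκ : IsDecayLaw κ) {a b : ℝ} (ha : 1 ≤ a) (hb : 1 ≤ b) :
    IntervalIntegrable (fun x => κ x / x) MeasureTheory.volume a b := by
  have hsub : Set.uIcc a b ⊆ Set.Ici 1 := fun x hx => (le_min ha hb).trans hx.1
  simp only [div_eq_mul_inv]
  refine ((hκ.antitone.mono hsub).intervalIntegrable).mul_continuousOn ?_
  exact continuousOn_inv₀.mono fun x hx => by
    have : (1 : ℝ) ≤ x := hsub hx
    simp only [Set.mem_compl_iff, Set.mem_singleton_iff]
    linarith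

lemma intervalIntegrable_inv_mul {a b c : ℝ} (ha : 1 ≤ a) (hb : 1 ≤ b) :
    IntervalIntegrable (fun x : ℝ => c * x⁻¹) MeasureTheory.volume a b :=
  ((intervalIntegrable_inv_iff.mpr (Or.inr fun h => by
    have := (le_min ha hb).trans h.1
    linarith))).const_mul c

lemma integral_const_mul_inv {a b c : ℝ} (ha : 1 ≤ a) (hb : 1 ≤ b) :
    ∫ x in a..b, c * x⁻¹ = c * (Real.log b - Real.log a) := by
  rw [intervalIntegral.integral_const_mul, integral_inv_of_pos (by linarith) (by linarith),
    Real.log_div (by linarith) (by linarith)]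

lemma IsDecayLaw.integral_le (hκ : IsDecayLaw κ) {a b c : ℝ} (ha : 1 ≤ a) (hab : a ≤ b)
    (hc : ∀ x ∈ Set.Icc a b, κ x ≤ c) :
    ∫ x in a..b, κ x / x ≤ c * (Real.log b - Real.log a) := by
  rw [← integral_const_mul_inv ha (ha.trans hab)]
  refine intervalIntegral.integral_mono_on hab (hκ.intervalIntegrable ha (ha.trans hab))
    (intervalIntegrable_inv_mul ha (ha.trans hab)) fun x hx => ?_
  rw [div_eq_mul_inv]
  exact mul_le_mul_of_nonneg_right (hc x hx) (inv_nonneg.mpr (by linarith [hx.1]))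

lemma IsDecayLaw.le_integral (hκ : IsDecayLaw κ) {a b c : ℝ} (ha : 1 ≤ a) (hab : a ≤ b)
    (hc : ∀ x ∈ Set.Icc a b, c ≤ κ x) :
    c * (Real.log b - Real.log a) ≤ ∫ x in a..b, κ x / x := by
  rw [← integral_const_mul_inv ha (ha.trans hab)]
  refine intervalIntegral.integral_mono_on hab (intervalIntegrable_inv_mul ha (ha.trans hab))
    (hκ.intervalIntegrable ha (ha.trans hab)) fun x hx => ?_
  rw [div_eq_mul_inv]
  exact mul_le_mul_of_nonneg_right (hc x hx) (inv_nonneg.mpr (by linarith [hx.1]))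

lemma IsDecayLaw.isBigO_log (hκ : IsDecayLaw κ) :
    (fun N : ℕ => ∫ x in (1 : ℝ)..(N : ℝ), κ x / x) =O[evenAtTop] fun N : ℕ => Real.log N := by
  obtain ⟨C, hC⟩ := hκ.bounded
  refine IsBigO.of_bound C ?_
  filter_upwards [eventually_ge 1] with N hN
  have hN' : (1 : ℝ) ≤ N := by exact_mod_cast hN
  have h1 := hκ.integral_le le_rfl hN' (c := C) fun x hx => (abs_le.mp (hC x hx.1)).2
  have h2 := hκ.le_integral le_rfl hN' (c := -C) fun x hx => (abs_le.mp (hC x hx.1)).1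
  rw [Real.log_one, sub_zero] at h1 h2
  rw [Real.norm_eq_abs, Real.norm_eq_abs, abs_of_nonneg (Real.log_nonneg hN'), abs_le]
  constructor <;> linarith

/-! ### Nonnegative decay laws -/

lemma IsDecayLaw.antitoneOn_div (hκ : IsDecayLaw κ) (h0 : ∀ x ∈ Set.Ici (1 : ℝ), 0 ≤ κ x) :
    AntitoneOn (fun x => κ x / x) (Set.Ici 1) := by
  intro x hx y hy hxy
  have hx' : (1 : ℝ) ≤ x := hx
  exact div_le_div₀ (h0 x hx) (hκ.antitone hx hy hxy) (by linarith) hxy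

lemma IsDecayLaw.integral_le_harmonic (hκ : IsDecayLaw κ)
    (h0 : ∀ x ∈ Set.Ici (1 : ℝ), 0 ≤ κ x) {N : ℕ} (hN : 0 < N) (hev : Even N) :
    ∫ x in (1 : ℝ)..(N : ℝ), κ x / x ≤ 2 * ∑ l ∈ Finset.Icc 1 (N / 2), κ l / l := by
  set M := N / 2 with hM
  have hNM : N = M + M := by obtain ⟨m, hm⟩ := hev; omega
  have hM1 : 1 ≤ M := by omega
  have hg := hκ.antitoneOn_div h0
  have hκ' : ∀ l : ℕ, 1 ≤ l → 0 ≤ κ l / l := fun l hl =>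
    div_nonneg (h0 _ (by simpa using hl)) (Nat.cast_nonneg l)
  have h1 := AntitoneOn.integral_le_sum_Ico (f := fun x => κ x / x) (show 1 ≤ N from hN)
    (hg.mono fun x hx => by simpa using hx.1)
  rw [Nat.cast_one] at h1
  refine h1.trans ?_
  rw [← Finset.sum_Ico_consecutive _ (show 1 ≤ M + 1 by omega) (show M + 1 ≤ N by omega)]
  have e1 : Finset.Ico 1 (M + 1) = Finset.Icc 1 M := by ext; simp
  -- the upper half of the sum is dominated by its neighbour `κ M`
  have h2 : ∑ l ∈ Finset.Ico (M + 1) N, κ l / l ≤ M * (κ M / M) := by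
    have : ∀ l ∈ Finset.Ico (M + 1) N, κ l / l ≤ κ M / M := by
      intro l hl
      rw [Finset.mem_Ico] at hl
      refine hg ?_ ?_ ?_
      · rw [Set.mem_Ici]; exact_mod_cast hM1
      · rw [Set.mem_Ici]; exact_mod_cast (by omega : 1 ≤ l)
      · exact_mod_cast (by omega : M ≤ l)
    refine (Finset.sum_le_card_nsmul _ _ _ this).trans ?_
    rw [Nat.card_Ico, nsmul_eq_mul]
    refine mul_le_mul_of_nonneg_right ?_ (hκ' M hM1)
    exact_mod_cast (by omega : N - (M + 1) ≤ M)
  have h3 : M * (κ M / M) ≤ ∑ l ∈ Finset.Icc 1 M, κ l / l := by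
    have hM0 : (M : ℝ) ≠ 0 := by
      have : M ≠ 0 := by omega
      exact_mod_cast this
    have hκM : κ M ≤ κ 1 / 1 := by
      rw [div_one, hκ.normalized]
      exact hκ.le_one (by exact_mod_cast hM1)
    rw [mul_div_cancel₀ _ hM0]
    refine hκM.trans ?_
    have := Finset.single_le_sum (f := fun l : ℕ => κ l / l) (s := Finset.Icc 1 M)
      (fun l hl => hκ' l (Finset.mem_Icc.mp hl).1) (Finset.mem_Icc.mpr ⟨le_rfl, hM1⟩)
    simpa using this
  rw [e1]
  linarith

lemma IsDecayLaw.harmonic_le_integral (hκ : IsDecayLaw κ)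
    (h0 : ∀ x ∈ Set.Ici (1 : ℝ), 0 ≤ κ x) {N : ℕ} (hN : 0 < N) (hev : Even N) :
    ∑ l ∈ Finset.Icc 1 (N / 2), κ l / l ≤ 1 + ∫ x in (1 : ℝ)..(N : ℝ), κ x / x := by
  set M := N / 2 with hM
  have hNM : N = M + M := by obtain ⟨m, hm⟩ := hev; omega
  have hM1 : 1 ≤ M := by omega
  have hM1' : (1 : ℝ) ≤ M := by exact_mod_cast hM1
  have hMN : (M : ℝ) ≤ N := by exact_mod_cast (by omega : M ≤ N)
  have h1 := AntitoneOn.sum_le_integral_Ico (f := fun x => κ x / x) hM1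
    ((hκ.antitoneOn_div h0).mono fun x hx => by simpa using hx.1)
  rw [Nat.cast_one] at h1
  have h2 : ∑ l ∈ Finset.Icc 1 M, κ l / l =
      1 + ∑ i ∈ Finset.Ico 1 M, κ ((i + 1 : ℕ) : ℝ) / ((i + 1 : ℕ) : ℝ) := by
    rw [show Finset.Icc 1 M = Finset.Ico 1 (M + 1) by ext; simp,
      Finset.sum_eq_sum_Ico_succ_bot (by omega),
      Finset.sum_Ico_add' (fun i : ℕ => κ i / i) 1 M 1]
    simp [hκ.normalized]
  have h3 := intervalIntegral.integral_add_adjacent_intervals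
    (hκ.intervalIntegrable le_rfl hM1') (hκ.intervalIntegrable hM1' (hM1'.trans hMN))
  have h4 : 0 ≤ ∫ x in (M : ℝ)..(N : ℝ), κ x / x :=
    intervalIntegral.integral_nonneg hMN fun x hx =>
      div_nonneg (h0 x (hM1'.trans hx.1)) (by linarith [hx.1])
  rw [h2]
  linarith

/-- Right-continuity at `1` bounds the integral away from zero. -/
lemma IsDecayLaw.exists_pos_le_integral (hκ : IsDecayLaw κ)
    (h0 : ∀ x ∈ Set.Ici (1 : ℝ), 0 ≤ κ x) :
    ∃ δ > 0, ∀ N : ℕ, 2 ≤ N → δ ≤ ∫ x in (1 : ℝ)..(N : ℝ), κ x / x := by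
  have h1 : ∀ᶠ x in nhdsWithin (1 : ℝ) (Set.Ici 1), 1 / 2 < κ x := by
    have := hκ.right_cont
    rw [ContinuousWithinAt, hκ.normalized] at this
    exact this.eventually_const_lt (by norm_num)
  obtain ⟨u, hu, hsub⟩ := mem_nhdsGE_iff_exists_Icc_subset.mp h1
  have hu1 : (1 : ℝ) < u := hu
  set v := min u 2
  have hv1 : 1 < v := lt_min hu1 (by norm_num)
  refine ⟨1 / 2 * Real.log v, by have := Real.log_pos hv1; positivity, fun N hN => ?_⟩
  have hvN : v ≤ N := (min_le_right _ _).trans (by exact_mod_cast hN)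
  have h2 := hκ.le_integral le_rfl hv1.le (c := 1 / 2) fun x hx =>
    (hsub ⟨hx.1, hx.2.trans (min_le_left _ _)⟩ : 1 / 2 < κ x).le
  rw [Real.log_one, sub_zero] at h2
  have h3 := intervalIntegral.integral_add_adjacent_intervals
    (hκ.intervalIntegrable le_rfl hv1.le) (hκ.intervalIntegrable hv1.le (hv1.le.trans hvN))
  have h4 : 0 ≤ ∫ x in v..(N : ℝ), κ x / x :=
    intervalIntegral.integral_nonneg hvN fun x hx =>
      div_nonneg (h0 x (hv1.le.trans hx.1)) (by linarith [hx.1])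
  linarith

lemma IsDecayLaw.gammaSum_isTheta_of_nonneg (hκ : IsDecayLaw κ)
    (h0 : ∀ x ∈ Set.Ici (1 : ℝ), 0 ≤ κ x) :
    gammaSum κ =Θ[evenAtTop] fun N : ℕ => (N : ℝ) * ∫ x in (1 : ℝ)..(N : ℝ), κ x / x := by
  obtain ⟨δ, hδ, hI⟩ := hκ.exists_pos_le_integral h0
  constructor
  · refine IsBigO.of_bound (12 * (1 / δ + 1)) ?_
    filter_upwards [eventually_ge 2, eventually_even] with N hN hev
    have h1 := gammaSum_le_harmonic κ hκ.antitone h0 (by omega) hev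
    have h2 := hκ.harmonic_le_integral h0 (by omega) hev
    have h3 := hI N hN
    have hI0 : 0 < ∫ x in (1 : ℝ)..(N : ℝ), κ x / x := hδ.trans_le h3
    rw [Real.norm_of_nonneg (gammaSum_nonneg κ N), Real.norm_of_nonneg (by positivity)]
    have h4 : 1 ≤ 1 / δ * ∫ x in (1 : ℝ)..(N : ℝ), κ x / x := by
      rw [one_div_mul_eq_div, le_div_iff₀ hδ]
      linarith
    calc _ ≤ _ := h1
      _ ≤ 12 * N * ((1 / δ + 1) * ∫ x in (1 : ℝ)..(N : ℝ), κ x / x) := by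
        refine mul_le_mul_of_nonneg_left ?_ (by positivity)
        linarith
      _ = _ := by ring
  · refine IsBigO.of_bound (2 * Real.pi) ?_
    filter_upwards [eventually_ge 2, eventually_even] with N hN hev
    have h1 := harmonic_le_gammaSum κ (by omega) hev fun l hl => h0 l (by simpa using hl)
    have h2 := hκ.integral_le_harmonic h0 (by omega) hev
    have hI0 : 0 < ∫ x in (1 : ℝ)..(N : ℝ), κ x / x := hδ.trans_le (hI N hN)
    have hpi := Real.pi_pos
    rw [Real.norm_of_nonneg (gammaSum_nonneg κ N), Real.norm_of_nonneg (by positivity)]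
    calc _ ≤ N * (2 * ∑ l ∈ Finset.Icc 1 (N / 2), κ l / l) :=
          mul_le_mul_of_nonneg_left h2 (Nat.cast_nonneg N)
      _ = 2 * Real.pi * (N / Real.pi * ∑ l ∈ Finset.Icc 1 (N / 2), κ l / l) := by field_simp
      _ ≤ _ := mul_le_mul_of_nonneg_left h1 (by positivity)

/-! ### Decay laws that become negative -/

lemma sum_inv_eq_harmonic (M : ℕ) : ∑ l ∈ Finset.Icc 1 M, (1 : ℝ) / l = harmonic M := by
  rw [harmonic_eq_sum_Icc]
  push_cast
  simp

lemma gammaSum_const_le {c : ℝ} (hc : 0 ≤ c) {N : ℕ} (hN : 0 < N) (hev : Even N) :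
    gammaSum (fun _ => c) N ≤ 12 * c * (N * (1 + Real.log N)) := by
  have h1 := gammaSum_le_harmonic (fun _ => c) antitoneOn_const (fun _ _ => hc) hN hev
  have h2 : ∑ l ∈ Finset.Icc 1 (N / 2), c / (l : ℝ) ≤ c * (1 + Real.log N) := by
    have h3 : ∑ l ∈ Finset.Icc 1 (N / 2), c / (l : ℝ) = c * harmonic (N / 2) := by
      rw [← sum_inv_eq_harmonic, Finset.mul_sum]
      exact Finset.sum_congr rfl fun l _ => by ring
    rw [h3]
    refine mul_le_mul_of_nonneg_left ((harmonic_le_one_add_log _).trans ?_) hc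
    have hpos : (0 : ℝ) < (N / 2 : ℕ) := by
      obtain ⟨m, hm⟩ := hev
      exact_mod_cast (by omega : 0 < N / 2)
    have : ((N / 2 : ℕ) : ℝ) ≤ N := by exact_mod_cast Nat.div_le_self N 2
    linarith [Real.log_le_log hpos this]
  calc _ ≤ _ := h1
    _ ≤ 12 * N * (c * (1 + Real.log N)) := mul_le_mul_of_nonneg_left h2 (by positivity)
    _ = _ := by ring

lemma IsDecayLaw.gammaSum_le (hκ : IsDecayLaw κ) {C : ℝ}
    (hC : ∀ x ∈ Set.Ici (1 : ℝ), |κ x| ≤ C) {N : ℕ} (hN : 0 < N) (hev : Even N) :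
    gammaSum κ N ≤ 36 * C * (N * (1 + Real.log N)) := by
  have hC0 : 0 ≤ C := (abs_nonneg _).trans (hC 1 Set.self_mem_Ici)
  -- `κ = (κ + C) - C` is a difference of nonnegative, nonincreasing couplings
  have h1 := gammaSum_add_le (fun x => κ x + C) (fun _ => -C) N
  simp only [add_neg_cancel_right, gammaSum_neg (fun _ => C)] at h1
  have h2 := gammaSum_const_le hC0 hN hev
  have h3 := gammaSum_le_harmonic (fun x => κ x + C) (fun x hx y hy hxy =>
    add_le_add_left (hκ.antitone hx hy hxy) C)
    (fun x hx => by linarith [(abs_le.mp (hC x hx)).1]) hN hev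
  have h4 : ∑ l ∈ Finset.Icc 1 (N / 2), (κ l + C) / (l : ℝ) ≤ 2 * C * (1 + Real.log N) := by
    have h5 : ∑ l ∈ Finset.Icc 1 (N / 2), (κ l + C) / (l : ℝ) ≤ 2 * C * harmonic (N / 2) := by
      rw [← sum_inv_eq_harmonic, Finset.mul_sum]
      refine Finset.sum_le_sum fun l hl => ?_
      have hl1 : (1 : ℝ) ≤ l := by exact_mod_cast (Finset.mem_Icc.mp hl).1
      rw [mul_one_div]
      exact div_le_div_of_nonneg_right (by linarith [(abs_le.mp (hC l hl1)).2]) (by linarith)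
    refine h5.trans (mul_le_mul_of_nonneg_left ((harmonic_le_one_add_log _).trans ?_)
      (by positivity))
    have hpos : (0 : ℝ) < (N / 2 : ℕ) := by
      obtain ⟨m, hm⟩ := hev
      exact_mod_cast (by omega : 0 < N / 2)
    have : ((N / 2 : ℕ) : ℝ) ≤ N := by exact_mod_cast Nat.div_le_self N 2
    linarith [Real.log_le_log hpos this]
  have h6 := mul_le_mul_of_nonneg_left h4 (by positivity : (0 : ℝ) ≤ 12 * N)
  linarith

lemma IsDecayLaw.gammaSum_ge_of_neg (hκ : IsDecayLaw κ) {C : ℝ}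
    (hC : ∀ x ∈ Set.Ici (1 : ℝ), |κ x| ≤ C) {x₀ : ℝ} (hx₀ : 1 ≤ x₀) (hneg : κ x₀ < 0) {N : ℕ}
    (hN : 0 < N) (hev : Even N) :
    N / Real.pi * (-κ x₀ * (Real.log N - Real.log 2)) ≤
      gammaSum κ N + 2 * ⌈x₀⌉₊ * (C - κ x₀) * N := by
  -- up to a coupling of finite range, `-κ` is bounded below by `-κ x₀ > 0`
  have h1 := gammaSum_add_le (fun x => -κ x) (fun x => max (-κ x) (-κ x₀) + κ x) N
  simp only [gammaSum_neg κ, neg_add_cancel_comm_assoc] at h1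
  have h2 := gammaSum_le_of_finite_range (fun x => max (-κ x) (-κ x₀) + κ x) (C := C - κ x₀)
    (L := ⌈x₀⌉₊) (fun l hl => ?_) (fun l hl hL => ?_) hN hev
  · have h3 := harmonic_le_gammaSum (fun x => max (-κ x) (-κ x₀)) hN hev
      fun l _ => le_max_of_le_right (by linarith)
    have h4 : -κ x₀ * (Real.log N - Real.log 2) ≤ ∑ l ∈ Finset.Icc 1 (N / 2),
        max (-κ l) (-κ x₀) / (l : ℝ) := by
      have h5 : -κ x₀ * harmonic (N / 2) ≤ ∑ l ∈ Finset.Icc 1 (N / 2),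
          max (-κ l) (-κ x₀) / (l : ℝ) := by
        rw [← sum_inv_eq_harmonic, Finset.mul_sum]
        refine Finset.sum_le_sum fun l _ => ?_
        rw [mul_one_div]
        exact div_le_div_of_nonneg_right (le_max_right _ _) (Nat.cast_nonneg l)
      refine le_trans (mul_le_mul_of_nonneg_left (le_trans ?_ (log_add_one_le_harmonic _))
        (by linarith)) h5
      have hN0 : (0 : ℝ) < N := by exact_mod_cast hN
      rw [← Real.log_div hN0.ne' two_ne_zero]
      refine Real.log_le_log (by positivity) ?_
      rw [div_le_iff₀ two_pos]
      exact_mod_cast (by omega : N ≤ (N / 2 + 1) * 2)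
    have hpi := Real.pi_pos
    have h6 := mul_le_mul_of_nonneg_left h4 (by positivity : (0 : ℝ) ≤ N / Real.pi)
    linarith
  · have hl1 : (l : ℝ) ∈ Set.Ici (1 : ℝ) := by rw [Set.mem_Ici]; exact_mod_cast hl
    have h3 := abs_le.mp (hC l hl1)
    have h4 := le_max_left (-κ l) (-κ x₀)
    rw [abs_of_nonneg (by linarith)]
    have : max (-κ l) (-κ x₀) ≤ -κ l + (C - κ x₀) := max_le (by linarith) (by linarith)
    linarith
  · have hl1 : (l : ℝ) ∈ Set.Ici (1 : ℝ) := by rw [Set.mem_Ici]; exact_mod_cast hl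
    have := hκ.antitone (Set.mem_Ici.mpr hx₀) hl1 ((Nat.le_ceil x₀).trans (by exact_mod_cast hL))
    rw [max_eq_left (by linarith), neg_add_cancel]

/-- A decay law that takes a negative value stays below it, and its harmonic sums diverge like the
logarithm. -/
lemma IsDecayLaw.gammaSum_isTheta_of_neg (hκ : IsDecayLaw κ) {x₀ : ℝ} (hx₀ : 1 ≤ x₀)
    (hneg : κ x₀ < 0) :
    gammaSum κ =Θ[evenAtTop] fun N : ℕ => (N : ℝ) * Real.log N := by
  obtain ⟨C, hC⟩ := hκ.bounded
  have hC0 : 0 ≤ C := (abs_nonneg _).trans (hC 1 Set.self_mem_Ici)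
  constructor
  · refine IsBigO.of_bound (72 * C) ?_
    filter_upwards [eventually_ge 1, eventually_even, eventually_le_log 1] with N hN hev hlog
    have h1 := hκ.gammaSum_le hC hN hev
    rw [Real.norm_of_nonneg (gammaSum_nonneg κ N), Real.norm_of_nonneg (by positivity)]
    refine h1.trans ?_
    have : C * (N * (1 + Real.log N)) ≤ C * (N * (2 * Real.log N)) := by gcongr; linarith
    linarith
  · have hb : 0 < -κ x₀ := by linarith
    have hpi := Real.pi_pos
    set A : ℝ := 2 * ⌈x₀⌉₊ * (C - κ x₀) with hA
    refine IsBigO.of_bound (2 * Real.pi / -κ x₀) ?_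
    filter_upwards [eventually_ge 1, eventually_even, eventually_le_log 0,
      eventually_le_log (2 * (Real.log 2 + Real.pi / -κ x₀ * A))] with N hN hev hlog0 hlog
    have h1 := hκ.gammaSum_ge_of_neg hC hx₀ hneg hN hev
    rw [← hA] at h1
    rw [Real.norm_of_nonneg (gammaSum_nonneg κ N), Real.norm_of_nonneg (by positivity)]
    have h2 := mul_le_mul_of_nonneg_left h1 (by positivity : 0 ≤ Real.pi / -κ x₀)
    have h3 : Real.pi / -κ x₀ * (N / Real.pi * (-κ x₀ * (Real.log N - Real.log 2))) =
        N * (Real.log N - Real.log 2) := by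
      have := hneg.ne
      field_simp
    have h4 : N * (2 * (Real.log 2 + Real.pi / -κ x₀ * A)) ≤ N * Real.log N :=
      mul_le_mul_of_nonneg_left hlog (Nat.cast_nonneg N)
    rw [h3] at h2
    have h5 : 2 * Real.pi / -κ x₀ * gammaSum κ N = 2 * (Real.pi / -κ x₀ * gammaSum κ N) := by ring
    rw [h5]
    linarith

lemma IsDecayLaw.integral_isTheta_of_neg (hκ : IsDecayLaw κ) {x₀ : ℝ} (hx₀ : 1 ≤ x₀)
    (hneg : κ x₀ < 0) :
    (fun N : ℕ => ∫ x in (1 : ℝ)..(N : ℝ), κ x / x) =Θ[evenAtTop] fun N : ℕ => Real.log N := by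
  refine ⟨hκ.isBigO_log, ?_⟩
  have hb : 0 < -κ x₀ := by linarith
  refine IsBigO.of_bound (2 / -κ x₀) ?_
  filter_upwards [eventually_ge ⌈x₀⌉₊, eventually_le_log 0,
    eventually_le_log (2 / -κ x₀ * ((1 - κ x₀) * Real.log x₀))] with N hN hlog0 hlog
  have hN' : x₀ ≤ N := (Nat.le_ceil x₀).trans (by exact_mod_cast hN)
  have h1 := hκ.integral_le le_rfl hx₀ (c := 1) fun x hx => hκ.le_one hx.1
  have h2 := hκ.integral_le hx₀ hN' (c := κ x₀) fun x hx =>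
    hκ.antitone hx₀ (hx₀.trans hx.1) hx.1
  have h3 := intervalIntegral.integral_add_adjacent_intervals
    (hκ.intervalIntegrable le_rfl hx₀) (hκ.intervalIntegrable hx₀ (hx₀.trans hN'))
  rw [Real.log_one, sub_zero, one_mul] at h1
  rw [Real.norm_of_nonneg hlog0, Real.norm_eq_abs]
  have h4 : -(∫ x in (1 : ℝ)..(N : ℝ), κ x / x) ≤ |∫ x in (1 : ℝ)..(N : ℝ), κ x / x| :=
    neg_le_abs _
  have h5 : -κ x₀ * Real.log N - (1 - κ x₀) * Real.log x₀ ≤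
      |∫ x in (1 : ℝ)..(N : ℝ), κ x / x| := by linarith
  rw [div_mul_eq_mul_div, div_le_iff₀ hb] at hlog
  rw [div_mul_eq_mul_div, le_div_iff₀ hb]
  linarith

theorem IsDecayLaw.gammaSum_isTheta (hκ : IsDecayLaw κ) :
    gammaSum κ =Θ[evenAtTop] fun N : ℕ => (N : ℝ) * ∫ x in (1 : ℝ)..(N : ℝ), κ x / x := by
  by_cases h0 : ∀ x ∈ Set.Ici (1 : ℝ), 0 ≤ κ x
  · exact hκ.gammaSum_isTheta_of_nonneg h0
  · push Not at h0
    obtain ⟨x₀, hx₀, hneg⟩ := h0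
    exact (hκ.gammaSum_isTheta_of_neg hx₀ hneg).trans
      ((isTheta_refl _ _).mul (hκ.integral_isTheta_of_neg hx₀ hneg).symm)

/-! ### Scaling of the optimal quantum Fisher information -/

variable {T : ℝ}

lemma optimalQFI_isTheta_gammaSum (κ : ℝ → ℝ) (J μ Δ : ℝ) (hT : 0 < T) :
    optimalQFI κ J μ Δ T =Θ[evenAtTop] fun N : ℕ => gammaSum κ N ^ 2 := by
  have h : optimalQFI κ J μ Δ T =ᶠ[evenAtTop] fun N : ℕ => (T ^ 2 / 4) * gammaSum κ N ^ 2 := by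
    filter_upwards [eventually_even] with N hev
    rw [optimalQFI_eq κ hev J μ Δ hT]
    ring
  exact h.trans_isTheta ((isTheta_const_mul_left (by positivity)).mpr (isTheta_refl _ _))

/-- The scaling of the optimal quantum Fisher information follows from that of the integral. -/
lemma IsDecayLaw.optimalQFI_isTheta (hκ : IsDecayLaw κ) (J μ Δ : ℝ) (hT : 0 < T) {g : ℕ → ℝ}
    (hg : (fun N : ℕ => ∫ x in (1 : ℝ)..(N : ℝ), κ x / x) =Θ[evenAtTop] g) :
    optimalQFI κ J μ Δ T =Θ[evenAtTop] fun N : ℕ => (N : ℝ) ^ 2 * g N ^ 2 := by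
  have h := ((hκ.gammaSum_isTheta.trans ((isTheta_refl _ _).mul hg)).pow 2)
  simp only [mul_pow] at h
  exact (optimalQFI_isTheta_gammaSum κ J μ Δ hT).trans h

lemma superHeisenberg_of_isTheta {I g : ℕ → ℝ}
    (hI : I =Θ[evenAtTop] fun N : ℕ => (N : ℝ) ^ 2 * g N) (hg : Tendsto g evenAtTop atTop) :
    SuperHeisenberg I := by
  have h1 : (fun _ : ℕ => (1 : ℝ)) =o[evenAtTop] g :=
    (isLittleO_one_left_iff ℝ).mpr (tendsto_norm_atTop_atTop.comp hg)
  have h2 := (isBigO_refl (fun N : ℕ => (N : ℝ) ^ 2) evenAtTop).mul_isLittleO h1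
  simp only [mul_one] at h2
  exact h2.trans_isTheta hI.symm

lemma not_superHeisenberg_of_isTheta {I : ℕ → ℝ}
    (hI : I =Θ[evenAtTop] fun N : ℕ => (N : ℝ) ^ 2) : ¬ SuperHeisenberg I := by
  intro h
  have h1 : (fun N : ℕ => (N : ℝ) ^ 2) =o[evenAtTop] fun N : ℕ => (N : ℝ) ^ 2 := h.trans_isTheta hI
  refine isLittleO_irrefl (Eventually.frequently ?_) h1
  filter_upwards [eventually_ge 1] with N hN
  have : (N : ℝ) ≠ 0 := by
    have : N ≠ 0 := by omega
    exact_mod_cast this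
  positivity

lemma isTheta_one_of_tendsto {g : ℕ → ℝ} {c : ℝ} (hc : c ≠ 0) (hg : Tendsto g atTop (nhds c)) :
    g =Θ[evenAtTop] fun _ => (1 : ℝ) :=
  (((isEquivalent_const_iff_tendsto hc).mpr (hg.mono_left evenAtTop_le)).isTheta).trans
    ((isTheta_const_const_iff).mpr (by simp [hc]))

lemma tendsto_log_natCast : Tendsto (fun N : ℕ => Real.log N) atTop atTop :=
  Real.tendsto_log_atTop.comp tendsto_natCast_atTop_atTop

/-! ### Power laws -/

lemma isDecayLaw_powerLaw {α : ℝ} (hα : 0 ≤ α) : IsDecayLaw (powerLaw α) where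
  normalized := Real.one_rpow _
  antitone := fun x hx y _ hxy =>
    Real.rpow_le_rpow_of_nonpos (zero_lt_one.trans_le hx) hxy (by linarith)
  bounded := ⟨1, fun x hx => by
    have hx0 : (0 : ℝ) ≤ x := zero_le_one.trans hx
    rw [powerLaw, abs_of_nonneg (Real.rpow_nonneg hx0 _)]
    exact Real.rpow_le_one_of_one_le_of_nonpos hx (by linarith)⟩
  right_cont := (Real.continuousAt_rpow_const 1 (-α) (Or.inl one_ne_zero)).continuousWithinAt

lemma integral_powerLaw_zero {N : ℕ} (hN : 1 ≤ N) :
    ∫ x in (1 : ℝ)..(N : ℝ), powerLaw 0 x / x = Real.log N := by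
  have hN' : (1 : ℝ) ≤ N := by exact_mod_cast hN
  simp only [powerLaw, neg_zero, Real.rpow_zero]
  rw [integral_one_div_of_pos one_pos (by linarith), div_one]

lemma integral_powerLaw {α : ℝ} (hα : 0 < α) {N : ℕ} (hN : 1 ≤ N) :
    ∫ x in (1 : ℝ)..(N : ℝ), powerLaw α x / x = (1 - (N : ℝ) ^ (-α)) / α := by
  have hN' : (1 : ℝ) ≤ N := by exact_mod_cast hN
  have h0 : (0 : ℝ) ∉ Set.uIcc 1 (N : ℝ) := by
    rw [Set.uIcc_of_le hN']
    exact fun h => absurd h.1 (by norm_num)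
  have h : ∫ x in (1 : ℝ)..(N : ℝ), powerLaw α x / x = ∫ x in (1 : ℝ)..(N : ℝ), x ^ (-α - 1) := by
    refine intervalIntegral.integral_congr fun x hx => ?_
    have hx0 : x ≠ 0 := fun h => h0 (h ▸ hx)
    simp only [powerLaw]
    rw [Real.rpow_sub_one hx0]
  rw [h, integral_rpow (Or.inr ⟨by linarith, h0⟩), sub_add_cancel, Real.one_rpow]
  field_simp
  ring

lemma integral_powerLaw_isTheta_one {α : ℝ} (hα : 0 < α) :
    (fun N : ℕ => ∫ x in (1 : ℝ)..(N : ℝ), powerLaw α x / x) =Θ[evenAtTop]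
      fun _ => (1 : ℝ) := by
  refine isTheta_one_of_tendsto (c := (1 - 0) / α) (by simp [hα.ne']) ?_
  refine Tendsto.congr' ?_ (((tendsto_const_nhds (x := (1 : ℝ))).sub
    ((tendsto_rpow_neg_atTop hα).comp tendsto_natCast_atTop_atTop)).div_const α)
  filter_upwards [eventually_ge_atTop 1] with N hN
  exact (integral_powerLaw hα hN).symm

lemma optimalQFI_powerLaw_zero (J μ Δ : ℝ) (hT : 0 < T) :
    optimalQFI (powerLaw 0) J μ Δ T =Θ[evenAtTop]
      fun N : ℕ => (N : ℝ) ^ 2 * (Real.log N) ^ 2 := by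
  refine (isDecayLaw_powerLaw le_rfl).optimalQFI_isTheta J μ Δ hT (EventuallyEq.isTheta ?_)
  filter_upwards [eventually_ge 1] with N hN
  exact integral_powerLaw_zero hN

lemma optimalQFI_powerLaw_pos (J μ Δ : ℝ) (hT : 0 < T) {α : ℝ} (hα : 0 < α) :
    optimalQFI (powerLaw α) J μ Δ T =Θ[evenAtTop] fun N : ℕ => (N : ℝ) ^ 2 := by
  have := (isDecayLaw_powerLaw hα.le).optimalQFI_isTheta J μ Δ hT
    (integral_powerLaw_isTheta_one hα)
  simpa using this

lemma superHeisenberg_powerLaw_iff (J μ Δ : ℝ) (hT : 0 < T) {α : ℝ} (hα : 0 ≤ α) :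
    SuperHeisenberg (optimalQFI (powerLaw α) J μ Δ T) ↔ α = 0 := by
  constructor
  · intro h
    by_contra h0
    exact not_superHeisenberg_of_isTheta
      (optimalQFI_powerLaw_pos J μ Δ hT (lt_of_le_of_ne hα (Ne.symm h0))) h
  · rintro rfl
    exact superHeisenberg_of_isTheta (optimalQFI_powerLaw_zero J μ Δ hT)
      (((tendsto_pow_atTop two_ne_zero).comp tendsto_log_natCast).mono_left evenAtTop_le)

/-! ### Logarithmic laws -/

lemma isDecayLaw_logLaw {α : ℝ} (hα : 0 ≤ α) : IsDecayLaw (logLaw α) where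
  normalized := by simp [logLaw]
  antitone := fun x hx y _ hxy => by
    have hx1 : (1 : ℝ) ≤ x := hx
    have h1 := Real.log_nonneg hx1
    have h2 := Real.log_le_log (by linarith) hxy
    exact Real.rpow_le_rpow_of_nonpos (by linarith) (by linarith) (by linarith)
  bounded := ⟨1, fun x hx => by
    have h1 := Real.log_nonneg hx
    rw [logLaw, abs_of_nonneg (Real.rpow_nonneg (by linarith) _)]
    exact Real.rpow_le_one_of_one_le_of_nonpos (by linarith) (by linarith)⟩
  right_cont := by
    have h : ContinuousAt (fun x : ℝ => 1 + Real.log x) 1 :=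
      continuousAt_const.add (Real.continuousAt_log one_ne_zero)
    exact (h.rpow_const (Or.inl (by simp))).continuousWithinAt

lemma integral_logLaw_eq_sub (α : ℝ) {F : ℝ → ℝ}
    (hF : ∀ y : ℝ, 1 ≤ y → HasDerivAt F (y ^ (-α)) y) {N : ℕ} (hα : 0 ≤ α) (hN : 1 ≤ N) :
    ∫ x in (1 : ℝ)..(N : ℝ), logLaw α x / x = F (1 + Real.log N) - F 1 := by
  have hN' : (1 : ℝ) ≤ N := by exact_mod_cast hN
  have h : ∀ x ∈ Set.uIcc 1 (N : ℝ),
      HasDerivAt (fun x => F (1 + Real.log x)) (logLaw α x / x) x := by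
    intro x hx
    rw [Set.uIcc_of_le hN'] at hx
    have hx0 : x ≠ 0 := by linarith [hx.1]
    have h1 := Real.log_nonneg hx.1
    exact (hF (1 + Real.log x) (by linarith)).comp x ((Real.hasDerivAt_log hx0).const_add 1)
  rw [intervalIntegral.integral_eq_sub_of_hasDerivAt h
    ((isDecayLaw_logLaw hα).intervalIntegrable le_rfl hN')]
  simp

lemma integral_logLaw_one {N : ℕ} (hN : 1 ≤ N) :
    ∫ x in (1 : ℝ)..(N : ℝ), logLaw 1 x / x = Real.log (1 + Real.log N) := by
  rw [integral_logLaw_eq_sub 1 (F := Real.log) (fun y hy => ?_) zero_le_one hN, Real.log_one,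
    sub_zero]
  rw [Real.rpow_neg_one]
  exact Real.hasDerivAt_log (by linarith)

lemma integral_logLaw {α : ℝ} (hα : 0 ≤ α) (hα1 : α ≠ 1) {N : ℕ} (hN : 1 ≤ N) :
    ∫ x in (1 : ℝ)..(N : ℝ), logLaw α x / x =
      ((1 + Real.log N) ^ (1 - α) - 1) / (1 - α) := by
  have h0 : 1 - α ≠ 0 := fun h => hα1 (by linarith)
  rw [integral_logLaw_eq_sub α (F := fun y => y ^ (1 - α) / (1 - α)) (fun y hy => ?_) hα hN,
    Real.one_rpow]
  · ring
  · have h1 := (Real.hasDerivAt_rpow_const (p := 1 - α) (x := y)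
      (Or.inl (by linarith))).div_const (1 - α)
    rwa [mul_div_cancel_left₀ _ h0, show 1 - α - 1 = -α by ring] at h1

lemma optimalQFI_logLaw_of_lt_one (J μ Δ : ℝ) (hT : 0 < T) {α : ℝ} (hα : 0 ≤ α) (hα1 : α < 1) :
    optimalQFI (logLaw α) J μ Δ T =Θ[evenAtTop]
      fun N : ℕ => (N : ℝ) ^ 2 * (Real.log N) ^ (2 * (1 - α)) := by
  have hs : 0 < 1 - α := by linarith
  have h1 : (fun N : ℕ => ∫ x in (1 : ℝ)..(N : ℝ), logLaw α x / x) =Θ[evenAtTop]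
      fun N : ℕ => (Real.log N) ^ (1 - α) := by
    have hlim : Tendsto (fun L : ℝ => (((1 + L) ^ (1 - α) - 1) / (1 - α)) / L ^ (1 - α)) atTop
        (nhds (((1 : ℝ) ^ (1 - α) - 0) / (1 - α))) := by
      -- `(1 + L) ^ s / L ^ s = (L⁻¹ + 1) ^ s` tends to `1`
      have e1 : Tendsto (fun L : ℝ => L⁻¹ + 1) atTop (nhds 1) := by
        simpa using tendsto_inv_atTop_zero.add_const (1 : ℝ)
      have e2 : Tendsto (fun L : ℝ => (L⁻¹ + 1) ^ (1 - α)) atTop (nhds ((1 : ℝ) ^ (1 - α))) :=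
        e1.rpow_const (Or.inl one_ne_zero)
      refine Tendsto.congr' ?_ ((e2.sub (tendsto_rpow_neg_atTop hs)).div_const (1 - α))
      filter_upwards [eventually_gt_atTop 0] with L hL
      rw [show L⁻¹ + 1 = (1 + L) / L by field_simp, Real.div_rpow (by linarith) hL.le,
        Real.rpow_neg hL.le]
      have := (Real.rpow_pos_of_pos hL (1 - α)).ne'
      field_simp
    have h2 := isTheta_one_of_tendsto (by simp [hs.ne']) (hlim.comp tendsto_log_natCast)
    have h3 := h2.mul (isTheta_refl (fun N : ℕ => (Real.log N) ^ (1 - α)) evenAtTop)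
    simp only [one_mul] at h3
    refine EventuallyEq.trans_isTheta ?_ h3
    filter_upwards [eventually_ge 1, eventually_le_log 1] with N hN hlog
    rw [integral_logLaw hα hα1.ne hN]
    have := (Real.rpow_pos_of_pos (by linarith : 0 < Real.log N) (1 - α)).ne'
    simp only [Function.comp_apply]
    field_simp
  refine ((isDecayLaw_logLaw hα).optimalQFI_isTheta J μ Δ hT h1).trans (EventuallyEq.isTheta ?_)
  filter_upwards [eventually_le_log 0] with N hlog
  rw [mul_comm 2 (1 - α), Real.rpow_mul hlog]
  norm_cast

lemma optimalQFI_logLaw_one (J μ Δ : ℝ) (hT : 0 < T) :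
    optimalQFI (logLaw 1) J μ Δ T =Θ[evenAtTop]
      fun N : ℕ => (N : ℝ) ^ 2 * (Real.log (Real.log N)) ^ 2 := by
  refine (isDecayLaw_logLaw zero_le_one).optimalQFI_isTheta J μ Δ hT ?_
  constructor
  · refine IsBigO.of_bound 2 ?_
    filter_upwards [eventually_ge 1, eventually_le_log 2] with N hN hlog
    have h0 : 0 ≤ Real.log (Real.log N) := Real.log_nonneg (by linarith)
    rw [integral_logLaw_one hN, Real.norm_of_nonneg (Real.log_nonneg (by linarith)),
      Real.norm_of_nonneg h0]
    have h1 : Real.log (1 + Real.log N) ≤ Real.log (Real.log N ^ 2) :=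
      Real.log_le_log (by linarith) (by nlinarith)
    rwa [Real.log_pow, Nat.cast_ofNat] at h1
  · refine IsBigO.of_bound 1 ?_
    filter_upwards [eventually_ge 1, eventually_le_log 2] with N hN hlog
    have h0 : 0 ≤ Real.log (Real.log N) := Real.log_nonneg (by linarith)
    rw [integral_logLaw_one hN, Real.norm_of_nonneg h0,
      Real.norm_of_nonneg (Real.log_nonneg (by linarith)), one_mul]
    exact Real.log_le_log (by linarith) (by linarith)

lemma optimalQFI_logLaw_of_one_lt (J μ Δ : ℝ) (hT : 0 < T) {α : ℝ} (hα1 : 1 < α) :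
    optimalQFI (logLaw α) J μ Δ T =Θ[evenAtTop] fun N : ℕ => (N : ℝ) ^ 2 := by
  have hs : 0 < α - 1 := by linarith
  have h1 : (fun N : ℕ => ∫ x in (1 : ℝ)..(N : ℝ), logLaw α x / x) =Θ[evenAtTop]
      fun _ => (1 : ℝ) := by
    refine isTheta_one_of_tendsto (c := (0 - 1) / (1 - α))
      (div_ne_zero (by norm_num) (by linarith)) ?_
    refine Tendsto.congr' ?_ ((((tendsto_rpow_neg_atTop hs).comp
      (tendsto_atTop_add_const_left atTop 1 tendsto_log_natCast)).sub_const 1).div_const (1 - α))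
    filter_upwards [eventually_ge_atTop 1] with N hN
    rw [integral_logLaw (by linarith) hα1.ne' hN, Function.comp_apply,
      show -(α - 1) = 1 - α by ring]
  have := (isDecayLaw_logLaw (by linarith : 0 ≤ α)).optimalQFI_isTheta J μ Δ hT h1
  simpa using this

lemma superHeisenberg_logLaw_iff (J μ Δ : ℝ) (hT : 0 < T) {α : ℝ} (hα : 0 ≤ α) :
    SuperHeisenberg (optimalQFI (logLaw α) J μ Δ T) ↔ α ≤ 1 := by
  constructor
  · intro h
    by_contra h0
    exact not_superHeisenberg_of_isTheta
      (optimalQFI_logLaw_of_one_lt J μ Δ hT (not_le.mp h0)) h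
  · intro h
    rcases h.lt_or_eq with h | rfl
    · exact superHeisenberg_of_isTheta (optimalQFI_logLaw_of_lt_one J μ Δ hT hα h)
        (((tendsto_rpow_atTop (by linarith : 0 < 2 * (1 - α))).comp
          tendsto_log_natCast).mono_left evenAtTop_le)
    · exact superHeisenberg_of_isTheta (optimalQFI_logLaw_one J μ Δ hT)
        (((tendsto_pow_atTop two_ne_zero).comp
          (Real.tendsto_log_atTop.comp tendsto_log_natCast)).mono_left evenAtTop_le)

end LRK

theorem mainTheorem1 (J μ Δ T : ℝ) (hT : 0 < T) :
    -- the optimally controlled QFI is `[γ(N) / 2] ^ 2 T ^ 2`, and it is attained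
    (∀ (κ : ℝ → ℝ) (N : ℕ), Even N →
      IsGreatest (LRK.attainableQFI κ J μ Δ T N) ((LRK.gammaSum κ N / 2) ^ 2 * T ^ 2) ∧
      LRK.optimalQFI κ J μ Δ T N = (LRK.gammaSum κ N / 2) ^ 2 * T ^ 2) ∧
    -- scaling for a general decay law, and the bound that it implies
    (∀ κ : ℝ → ℝ, LRK.IsDecayLaw κ →
      (LRK.optimalQFI κ J μ Δ T =Θ[LRK.evenAtTop]
        fun N : ℕ => (N : ℝ) ^ 2 * (∫ x in (1 : ℝ)..(N : ℝ), κ x / x) ^ 2) ∧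
      (LRK.optimalQFI κ J μ Δ T =O[LRK.evenAtTop]
        fun N : ℕ => (N : ℝ) ^ 2 * (Real.log N) ^ 2)) ∧
    -- power laws
    (∀ α : ℝ, 0 ≤ α →
      (α = 0 → LRK.optimalQFI (LRK.powerLaw α) J μ Δ T =Θ[LRK.evenAtTop]
        fun N : ℕ => (N : ℝ) ^ 2 * (Real.log N) ^ 2) ∧
      (0 < α → LRK.optimalQFI (LRK.powerLaw α) J μ Δ T =Θ[LRK.evenAtTop]
        fun N : ℕ => (N : ℝ) ^ 2) ∧
      (LRK.SuperHeisenberg (LRK.optimalQFI (LRK.powerLaw α) J μ Δ T) ↔ α = 0)) ∧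
    -- logarithmic laws
    (∀ α : ℝ, 0 ≤ α →
      (α < 1 → LRK.optimalQFI (LRK.logLaw α) J μ Δ T =Θ[LRK.evenAtTop]
        fun N : ℕ => (N : ℝ) ^ 2 * (Real.log N) ^ (2 * (1 - α))) ∧
      (α = 1 → LRK.optimalQFI (LRK.logLaw α) J μ Δ T =Θ[LRK.evenAtTop]
        fun N : ℕ => (N : ℝ) ^ 2 * (Real.log (Real.log N)) ^ 2) ∧
      (1 < α → LRK.optimalQFI (LRK.logLaw α) J μ Δ T =Θ[LRK.evenAtTop]
        fun N : ℕ => (N : ℝ) ^ 2) ∧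
      (LRK.SuperHeisenberg (LRK.optimalQFI (LRK.logLaw α) J μ Δ T) ↔ α ≤ 1)) := by
  refine ⟨fun κ N hev => ⟨LRK.isGreatest_attainableQFI κ hev J μ Δ hT,
    LRK.optimalQFI_eq κ hev J μ Δ hT⟩, fun κ hκ => ⟨?_, ?_⟩, fun α hα => ⟨?_, ?_, ?_⟩,
    fun α hα => ⟨?_, ?_, ?_, ?_⟩⟩
  · exact hκ.optimalQFI_isTheta J μ Δ hT (isTheta_refl _ _)
  · exact (hκ.optimalQFI_isTheta J μ Δ hT (isTheta_refl _ _)).1.trans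
      ((isBigO_refl _ _).mul (hκ.isBigO_log.pow 2))
  · rintro rfl
    exact LRK.optimalQFI_powerLaw_zero J μ Δ hT
  · exact LRK.optimalQFI_powerLaw_pos J μ Δ hT
  · exact LRK.superHeisenberg_powerLaw_iff J μ Δ hT hα
  · exact LRK.optimalQFI_logLaw_of_lt_one J μ Δ hT hα
  · rintro rfl
    exact LRK.optimalQFI_logLaw_one J μ Δ hT
  · exact LRK.optimalQFI_logLaw_of_one_lt J μ Δ hT
  · exact LRK.superHeisenberg_logLaw_iff J μ Δ hT hα
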